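/- Let $b>0$, $\gamma\in(0,1)$, and consider the zero-range process with jump rates $g(0)=0$, $g(n)=1+b/n^{\gamma}$ for $n\ge 1$. Let $w(n)=\prod_{k=1}^{n}g(k)^{-1}$ (so $w(0)=1$) be its stationary weights, let $\nu_1[n]=w(n)/\sum_{k\ge0}w(k)$ be the critical single-site measure, and let $\rho_c=\sum_n n\,\nu_1[n]$ and $\sigma_c^2=\sum_n n^2\nu_1[n]-\rho_c^2$ be its mean and variance (both finite). For $L$ sites and $N$ particles let $\pi_{L,N}$ be the canonical measure, i.e. the probability measure on $\{\eta\in\mathbb N_0^{L}:\sum_x\eta_x=N\}$ with $\pi_{L,N}[\eta]\propto\prod_x w(\eta_x)$, let $M_L(\eta)=\max_x\eta_x$, and put $$I_{L,N}(m)=-\frac1L\log\pi_{L,N}[M_L=m].$$ Let $\alpha=\frac{\gamma}{1+\gamma}$, $\beta=\frac{1-\gamma}{1+\gamma}$, let $0\le\delta\rho_{bg}<\delta\rho$ be real numbers with $$\frac{\delta\rho_{bg}}{\sigma_c^2}<\frac{b}{(1-\gamma)(\delta\rho-\delta\rho_{bg})^{\gamma}},$$ and let $N=N_L$ and $m=m_L$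 be nonnegative integers such that, as $L\to\infty$, $$N=\rho_cL+\delta\rho\,L^{1-\alpha}+o(L^{1-\alpha}),\qquad m=(\delta\rho-\delta\rho_{bg})L^{1-\alpha}+o(L^{1-\alpha}).$$ Then $\pi_{L,N}[M_L=m]>0$ for all sufficiently large $L$, and $$\lim_{L\to\infty}L^{1-\beta}I_{L,N}(m)=\frac{\delta\rho_{bg}^2}{2\sigma_c^2}+\frac{b}{1-\gamma}(\delta\rho-\delta\rho_{bg})^{1-\gamma}-\inf_{r\in(0,\delta\rho)}\left\{\frac{r^2}{2\sigma_c^2}+\frac{b}{1-\gamma}(\delta\rho-r)^{1-\gamma}\right\}.$$ -/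

import Mathlib

open Filter Topology Asymptotics

namespace ZeroRange

noncomputable section

/-- The jump rates `g(0) = 0`, `g(n) = 1 + b / n ^ γ` for `n > 0`. -/
def jumpRate (b γ : ℝ) (n : ℕ) : ℝ :=
  if n = 0 then 0 else 1 + b / (n : ℝ) ^ γ

/-- The stationary weights `w(n) = ∏_{k=1}^n g(k)⁻¹`, with `w(0) = 1`. -/
def weight (b γ : ℝ) (n : ℕ) : ℝ :=
  ∏ k ∈ Finset.Icc 1 n, (jumpRate b γ k)⁻¹

/-- The single site partition function `z(φ) = ∑_k w(k) φ ^ k`. -/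
def siteZ (b γ φ : ℝ) : ℝ :=
  ∑' k : ℕ, weight b γ k * φ ^ k

/-- The single site grand canonical probabilities `ν_φ[n] = w(n) φ ^ n / z(φ)`. -/
def gcMass (b γ φ : ℝ) (n : ℕ) : ℝ :=
  weight b γ n * φ ^ n / siteZ b γ φ

/-- The grand canonical density `R(φ) = E_{ν_φ}[η]`. -/
def density (b γ φ : ℝ) : ℝ :=
  ∑' k : ℕ, (k : ℝ) * gcMass b γ φ k

/-- The critical density `ρ_c = R(1)`; the radius of convergence of `z` is `φ_c = 1`, and all
moments of `ν_1` are finite, because the weights decay as a stretched exponential. -/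
def critDensity (b γ : ℝ) : ℝ :=
  density b γ 1

/-- The critical variance `σ_c² = E_{ν_1}[η²] - ρ_c²`. -/
def critVariance (b γ : ℝ) : ℝ :=
  (∑' k : ℕ, (k : ℝ) ^ 2 * gcMass b γ 1 k) - critDensity b γ ^ 2

/-- The configurations of `N` particles on `L` sites: all `η : Fin L → ℕ` with `∑ x, η x = N`. -/
def configs (L N : ℕ) : Finset (Fin L → ℕ) :=
  Finset.piAntidiag Finset.univ N

/-- The canonical partition function `Z(L, N)`. -/
def canonicalZ (b γ : ℝ) (L N : ℕ) : ℝ :=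
  ∑ η ∈ configs L N, ∏ x, weight b γ (η x)

/-- The probability `π_{L,N}[A]` of an event `A` under the canonical measure, which gives a
configuration `η` with `N` particles the mass `Z(L, N)⁻¹ ∏ x, w(η x)`. -/
def canonicalProb (b γ : ℝ) (L N : ℕ) (A : Set (Fin L → ℕ)) : ℝ :=
  ∑ η ∈ configs L N, A.indicator (fun ξ => (∏ x, weight b γ (ξ x)) / canonicalZ b γ L N) η

/-- The maximal occupation number `M_L(η) = max_x η x`. -/
def maxOcc {L : ℕ} (η : Fin L → ℕ) : ℕ :=
  Finset.univ.sup η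

/-- `I_{L,N}(m) = -(1/L) log π_{L,N}[M_L = m]`. -/
def rateFun (b γ : ℝ) (L N m : ℕ) : ℝ :=
  -(1 / (L : ℝ)) * Real.log (canonicalProb b γ L N {η | maxOcc η = m})

end

end ZeroRange

/-!
Write `ν` for the critical single site measure, `ℓ = L^(1/(1+γ))` for the order of the particle
excess, `T = ℓ^(1-γ) = ℓ²/L` for the speed and `c = b/(1-γ)`. The canonical measure is the product
measure of `ν` conditioned on the particle number, so both the numerator `P(S = N, M = m)` and the
denominator `P(S = N)` of the probability in question can be treated for independent sites. With
`J(r) = r²/(2σ²) + c (δ-r)^(1-γ)`, the theorem is that `-log P(S = N, M = m) / T → J(δ_bg)` and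
`-log P(S = N) / T → inf J`.

Two inputs carry the proof. First, `log ν[n] ∼ -c n^(1-γ)` (`tendsto_log_weight`), so a site with
`vℓ` particles costs `c v^(1-γ)` at speed `T`. Second, a second order expansion of exponential
moments at parameter `tℓ^(-γ)` (`IsModerateTilt.summable_and_tendsto`): truncated at `κℓ`, or
continued beyond `κℓ` by a stretched exponential of rate `c' < c`, the `L`-th power of the centred
moment is `exp (T (t²σ²/2 + o(1)))`, as long as `|t| κ^γ ≤ c'`. This follows from dominated
convergence and replaces any limit theorem.

* Lower bound (`eventually_le_sum_maxOcc`): put `m` particles on one site. The other sites carry an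
  excess within a window of width `εℓ`, which costs `r²/(2σ²)`; the tilted probability of the window
  is controlled by comparing moments at neighbouring parameters (`eventually_le_sum_window`). One
  further site with `O(εℓ)` particles makes the total exact, at a cost that vanishes with `ε`; so no
  local limit theorem is needed. A near-optimal choice of `m` also gives the lower bound for
  `P(S = N)`.
* Upper bound for `P(S = N, M = m)` (`eventually_sum_maxOcc_le`): a Chernoff bound with parameter
  `t = δ_bg/σ²`, truncated at the maximum. The condition on `δ_bg` is `t κ^γ < c` at
  `κ = δ - δ_bg`.
* Upper bound for `P(S = N)` (`eventually_sum_configs_le`): several sites may be highly occupied.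
  Weighting each such site by `exp (c' x^(1-γ))`, concavity shows that they cost at least as much as
  a single site with all their particles; the Chernoff parameter is chosen from a finite net
  according to how many particles they carry.
-/

namespace ZeroRange

/-! ### Stretched exponential decay of the stationary weights -/

section Weights

variable {b γ : ℝ}

lemma weight_zero : weight b γ 0 = 1 := by simp [weight]

lemma weight_succ (n : ℕ) :
    weight b γ (n + 1) = weight b γ n * (1 + b / ((n + 1 : ℕ) : ℝ) ^ γ)⁻¹ := by
  rw [weight, Finset.prod_Icc_succ_top (by omega), weight, jumpRate, if_neg (by omega)]

lemma one_lt_rate (hb : 0 < b) (n : ℕ) : 1 < 1 + b / ((n + 1 : ℕ) : ℝ) ^ γ := by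
  have : 0 < b / ((n + 1 : ℕ) : ℝ) ^ γ := by positivity
  linarith

lemma weight_pos (hb : 0 < b) (n : ℕ) : 0 < weight b γ n := by
  induction n with
  | zero => simp [weight_zero]
  | succ n ih =>
    rw [weight_succ]
    have := one_lt_rate (γ := γ) hb n
    positivity

lemma weight_antitone (hb : 0 < b) : Antitone (weight b γ) := by
  refine antitone_nat_of_succ_le fun n => ?_
  rw [weight_succ]
  exact mul_le_of_le_one_right (weight_pos hb n).le
    (inv_le_one_of_one_le₀ (one_lt_rate hb n).le)

lemma log_weight (hb : 0 < b) (n : ℕ) :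
    Real.log (weight b γ n)
      = -∑ k ∈ Finset.range n, Real.log (1 + b * ((k : ℝ) + 1) ^ (-γ)) := by
  induction n with
  | zero => simp [weight_zero]
  | succ n ih =>
    have h := one_lt_rate (γ := γ) hb n
    rw [weight_succ, Real.log_mul (weight_pos hb n).ne' (inv_ne_zero (by linarith)),
      Real.log_inv, ih, Finset.sum_range_succ, Real.rpow_neg (by positivity)]
    push_cast
    rw [div_eq_mul_inv]
    ring

/-- The weights decay as the stretched exponential `exp (-b n^(1-γ) / (1-γ))` to leading
exponential order: the logarithm of the product is compared with the telescoping sum of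
`k^(1-γ)`. -/
lemma tendsto_log_weight (hb : 0 < b) (hγ0 : 0 < γ) (hγ1 : γ < 1) :
    Tendsto (fun n : ℕ => Real.log (weight b γ n) / (n : ℝ) ^ (1 - γ)) atTop
      (𝓝 (-(b / (1 - γ)))) := by
  have h1γ : 0 < 1 - γ := by linarith
  set c := b / (1 - γ) with hc
  set g : ℕ → ℝ := fun k => ((k + 1 : ℕ) : ℝ) ^ (1 - γ) - (k : ℝ) ^ (1 - γ) with hg
  have hgpos : ∀ k, 0 < g k := fun k => by
    have : (k : ℝ) ^ (1 - γ) < ((k + 1 : ℕ) : ℝ) ^ (1 - γ) :=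
      Real.rpow_lt_rpow (by positivity) (by push_cast; linarith) h1γ
    simp only [hg]; linarith
  have hgsum : ∀ n, ∑ i ∈ Finset.range n, g i = (n : ℝ) ^ (1 - γ) := fun n => by
    rw [Finset.sum_range_sub (fun k : ℕ => (k : ℝ) ^ (1 - γ))]
    simp [Real.zero_rpow h1γ.ne']
  have hcast : Tendsto (fun k : ℕ => (k : ℝ) + 1) atTop atTop :=
    tendsto_atTop_add_const_right _ _ tendsto_natCast_atTop_atTop
  -- the increments at the scale `s = (k+1)^(-γ)`
  have hs : Tendsto (fun k : ℕ => ((k : ℝ) + 1) ^ (-γ)) atTop (𝓝[≠] 0) := by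
    refine tendsto_nhdsWithin_iff.2 ⟨(tendsto_rpow_neg_atTop hγ0).comp hcast, ?_⟩
    exact Eventually.of_forall fun k => (by positivity : ((k : ℝ) + 1) ^ (-γ) ≠ 0)
  have hu : Tendsto (fun k : ℕ => ((k : ℝ) + 1)⁻¹) atTop (𝓝[≠] 0) := by
    refine tendsto_nhdsWithin_iff.2 ⟨tendsto_inv_atTop_zero.comp hcast, ?_⟩
    exact Eventually.of_forall fun k => (by positivity : ((k : ℝ) + 1)⁻¹ ≠ 0)
  have hA : Tendsto (fun k : ℕ => (((k : ℝ) + 1) ^ (-γ))⁻¹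
      * Real.log (1 + b * ((k : ℝ) + 1) ^ (-γ))) atTop (𝓝 b) := by
    have hd : HasDerivAt (fun s : ℝ => Real.log (1 + b * s)) b 0 := by
      have h1 : HasDerivAt (fun s : ℝ => 1 + b * s) b 0 := by
        simpa using ((hasDerivAt_id (0 : ℝ)).const_mul b).const_add 1
      simpa using h1.log (by simp)
    have := (hasDerivAt_iff_tendsto_slope_zero.1 hd).comp hs
    refine this.congr fun k => ?_
    simp
  have hB : Tendsto (fun k : ℕ => (((k : ℝ) + 1)⁻¹)⁻¹
      * (1 - (1 - ((k : ℝ) + 1)⁻¹) ^ (1 - γ))) atTop (𝓝 (1 - γ)) := by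
    have hd : HasDerivAt (fun s : ℝ => 1 - (1 - s) ^ (1 - γ)) (1 - γ) 0 := by
      have h1 : HasDerivAt (fun s : ℝ => 1 - s) (-1) 0 := by
        simpa using (hasDerivAt_id (0 : ℝ)).const_sub 1
      simpa using (h1.rpow_const (p := 1 - γ) (by simp)).const_sub 1
    have := (hasDerivAt_iff_tendsto_slope_zero.1 hd).comp hu
    refine this.congr fun k => ?_
    simp
  have hgB : ∀ k : ℕ, g k = ((k : ℝ) + 1) ^ (-γ)
      * ((((k : ℝ) + 1)⁻¹)⁻¹ * (1 - (1 - ((k : ℝ) + 1)⁻¹) ^ (1 - γ))) := fun k => by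
    have hk : (0 : ℝ) < (k : ℝ) + 1 := by positivity
    have e1 : 1 - ((k : ℝ) + 1)⁻¹ = k / ((k : ℝ) + 1) := by field_simp; ring
    rw [e1, Real.div_rpow (by positivity) hk.le, inv_inv, ← mul_assoc,
      show ((k : ℝ) + 1) ^ (-γ) * ((k : ℝ) + 1) = ((k : ℝ) + 1) ^ (1 - γ) by
        rw [← Real.rpow_add_one hk.ne']; ring_nf]
    simp only [hg]
    push_cast
    field_simp
  have ho : (fun k : ℕ => Real.log (1 + b * ((k : ℝ) + 1) ^ (-γ)) - c * g k)
      =o[atTop] g := by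
    refine isLittleO_of_tendsto (fun k hk => absurd hk (hgpos k).ne') ?_
    have hlim : Tendsto (fun k : ℕ => ((((k : ℝ) + 1) ^ (-γ))⁻¹
        * Real.log (1 + b * ((k : ℝ) + 1) ^ (-γ)))
        / ((((k : ℝ) + 1)⁻¹)⁻¹ * (1 - (1 - ((k : ℝ) + 1)⁻¹) ^ (1 - γ))) - c) atTop (𝓝 0) := by
      have := (hA.div hB h1γ.ne').sub_const c
      simpa [hc] using this
    refine hlim.congr fun k => ?_
    have hgk := (hgpos k).ne'
    rw [sub_div, mul_div_cancel_right₀ _ hgk, hgB k, inv_mul_eq_div, div_div]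
  have hsum := ho.sum_range (fun k => (hgpos k).le) (by
    simp_rw [hgsum]
    exact (tendsto_rpow_atTop h1γ).comp tendsto_natCast_atTop_atTop)
  have hlim := hsum.tendsto_div_nhds_zero
  simp_rw [hgsum, Finset.sum_sub_distrib, ← Finset.mul_sum, hgsum] at hlim
  have := (hlim.neg).sub_const c
  rw [neg_zero, zero_sub] at this
  refine this.congr' ?_
  filter_upwards [eventually_gt_atTop 0] with n hn
  have hn' : (0 : ℝ) < (n : ℝ) ^ (1 - γ) := Real.rpow_pos_of_pos (by exact_mod_cast hn) _
  rw [log_weight hb]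
  field_simp
  ring

lemma exists_weight_le (hb : 0 < b) (hγ0 : 0 < γ) (hγ1 : γ < 1) {c' : ℝ}
    (hc' : c' < b / (1 - γ)) :
    ∃ C : ℝ, 0 < C ∧ ∀ n : ℕ, weight b γ n ≤ C * Real.exp (-c' * (n : ℝ) ^ (1 - γ)) := by
  have hev : ∀ᶠ n : ℕ in atTop, weight b γ n ≤ Real.exp (-c' * (n : ℝ) ^ (1 - γ)) := by
    filter_upwards [(tendsto_log_weight hb hγ0 hγ1).eventually_lt_const (neg_lt_neg hc'),
      eventually_gt_atTop 0] with n hn hn0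
    have hn' : (0 : ℝ) < (n : ℝ) ^ (1 - γ) := Real.rpow_pos_of_pos (by exact_mod_cast hn0) _
    rw [div_lt_iff₀ hn'] at hn
    exact (Real.log_le_iff_le_exp (weight_pos hb n)).1 hn.le
  obtain ⟨n₀, hn₀⟩ := eventually_atTop.1 hev
  set f : ℕ → ℝ := fun n => weight b γ n / Real.exp (-c' * (n : ℝ) ^ (1 - γ)) with hf
  have hf0 : ∀ n, 0 < f n := fun n => div_pos (weight_pos hb n) (Real.exp_pos _)
  refine ⟨1 + ∑ k ∈ Finset.range n₀, f k,
    by linarith [Finset.sum_nonneg fun k (_ : k ∈ Finset.range n₀) => (hf0 k).le], fun n => ?_⟩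
  rw [← div_le_iff₀ (Real.exp_pos _)]
  have hS := Finset.sum_nonneg fun k (_ : k ∈ Finset.range n₀) => (hf0 k).le
  by_cases hn : n < n₀
  · have := Finset.single_le_sum (fun k (_ : k ∈ Finset.range n₀) => (hf0 k).le)
      (Finset.mem_range.2 hn)
    change f n ≤ _
    linarith
  · have := (div_le_one (Real.exp_pos (-c' * (n : ℝ) ^ (1 - γ)))).2 (hn₀ n (by omega))
    linarith

/-- Below the critical rate `b / (1-γ)`, stretched exponential moments of the weights are
finite, also with a polynomial factor. -/
lemma summable_weight_mul_exp (hb : 0 < b) (hγ0 : 0 < γ) (hγ1 : γ < 1) {c' : ℝ}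
    (hc' : c' < b / (1 - γ)) (p : ℕ) :
    Summable fun n : ℕ =>
      weight b γ n * ((1 + (n : ℝ)) ^ p * Real.exp (c' * (n : ℝ) ^ (1 - γ))) := by
  have h1γ : 0 < 1 - γ := by linarith
  obtain ⟨c₁, h1, h2⟩ := exists_between hc'
  obtain ⟨C, hC, hw⟩ := exists_weight_le hb hγ0 hγ1 h2
  have hO : (fun n : ℕ => (1 + (n : ℝ)) ^ p * Real.exp (-(c₁ - c') * (n : ℝ) ^ (1 - γ)))
      =O[atTop] fun n : ℕ => (n : ℝ) ^ (-2 : ℝ) := by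
    have e1 : (fun n : ℕ => (1 + (n : ℝ)) ^ p) =O[atTop] fun n : ℕ => (n : ℝ) ^ (p : ℝ) := by
      refine IsBigO.of_bound (2 ^ p) ?_
      filter_upwards [eventually_ge_atTop 1] with n hn
      have : (1 : ℝ) ≤ n := by exact_mod_cast hn
      rw [Real.norm_of_nonneg (by positivity), Real.norm_of_nonneg (by positivity),
        Real.rpow_natCast, ← mul_pow]
      gcongr
      linarith
    have e2 : (fun n : ℕ => Real.exp (-(c₁ - c') * (n : ℝ) ^ (1 - γ)))
        =O[atTop] fun n : ℕ => (n : ℝ) ^ (-2 - p : ℝ) := by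
      have := ((isLittleO_exp_neg_mul_rpow_atTop (sub_pos.2 h1)
        ((-2 - p : ℝ) / (1 - γ))).comp_tendsto
        ((tendsto_rpow_atTop h1γ).comp tendsto_natCast_atTop_atTop)).isBigO
      refine this.congr_right fun n => ?_
      simp only [Function.comp]
      rw [← Real.rpow_mul (by positivity)]
      congr 1
      field_simp
    refine (e1.mul e2).congr' EventuallyEq.rfl ?_
    filter_upwards [eventually_gt_atTop 0] with n hn
    rw [← Real.rpow_add (by exact_mod_cast hn)]
    congr 1
    ring
  have hsum := (summable_of_isBigO_nat (Real.summable_nat_rpow.2 (by norm_num)) hO).mul_left C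
  refine Summable.of_nonneg_of_le (fun n => ?_) (fun n => ?_) hsum
  · have := weight_pos (γ := γ) hb n
    positivity
  · have e : Real.exp (-(c₁ - c') * (n : ℝ) ^ (1 - γ))
        = Real.exp (-c₁ * (n : ℝ) ^ (1 - γ)) * Real.exp (c' * (n : ℝ) ^ (1 - γ)) := by
      rw [← Real.exp_add]; ring_nf
    rw [e]
    calc _ ≤ (C * Real.exp (-c₁ * (n : ℝ) ^ (1 - γ)))
          * ((1 + (n : ℝ)) ^ p * Real.exp (c' * (n : ℝ) ^ (1 - γ))) := by
            gcongr; exact hw n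
      _ = _ := by ring

end Weights

/-! ### Moments of the critical single site measure -/

section CriticalMeasure

variable {b γ : ℝ}

lemma summable_pow_mul_weight (hb : 0 < b) (hγ0 : 0 < γ) (hγ1 : γ < 1) (p : ℕ) :
    Summable fun n : ℕ => (n : ℝ) ^ p * weight b γ n := by
  have h := summable_weight_mul_exp hb hγ0 hγ1 (div_pos hb (sub_pos.2 hγ1)) p
  refine Summable.of_nonneg_of_le (fun n => ?_) (fun n => ?_) h
  · have := weight_pos (γ := γ) hb n
    positivity
  · have := weight_pos (γ := γ) hb n
    rw [zero_mul, Real.exp_zero, mul_one, mul_comm]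
    gcongr
    linarith

lemma siteZ_one_pos (hb : 0 < b) (hγ0 : 0 < γ) (hγ1 : γ < 1) : 0 < siteZ b γ 1 := by
  have h := summable_pow_mul_weight hb hγ0 hγ1 0
  simp only [pow_zero, one_mul] at h
  simp only [siteZ, one_pow, mul_one]
  exact h.tsum_pos (fun n => (weight_pos hb n).le) 0 (weight_pos hb 0)

lemma gcMass_one (n : ℕ) : gcMass b γ 1 n = weight b γ n / siteZ b γ 1 := by
  simp [gcMass]

lemma gcMass_one_pos (hb : 0 < b) (hγ0 : 0 < γ) (hγ1 : γ < 1) (n : ℕ) :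
    0 < gcMass b γ 1 n := by
  rw [gcMass_one]
  exact div_pos (weight_pos hb n) (siteZ_one_pos hb hγ0 hγ1)

lemma hasSum_gcMass_one (hb : 0 < b) (hγ0 : 0 < γ) (hγ1 : γ < 1) :
    HasSum (gcMass b γ 1) 1 := by
  have h := summable_pow_mul_weight hb hγ0 hγ1 0
  simp only [pow_zero, one_mul] at h
  have h2 := h.hasSum.div_const (siteZ b γ 1)
  have h3 : ∑' n, weight b γ n = siteZ b γ 1 := by simp [siteZ]
  rw [h3, div_self (siteZ_one_pos hb hγ0 hγ1).ne'] at h2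
  exact h2.congr_fun fun n => gcMass_one n

lemma summable_pow_mul_gcMass_one (hb : 0 < b) (hγ0 : 0 < γ) (hγ1 : γ < 1) (p : ℕ) :
    Summable fun n : ℕ => (n : ℝ) ^ p * gcMass b γ 1 n := by
  refine ((summable_pow_mul_weight hb hγ0 hγ1 p).div_const (siteZ b γ 1)).congr fun n => ?_
  rw [gcMass_one, mul_div_assoc]

lemma hasSum_mul_gcMass_one (hb : 0 < b) (hγ0 : 0 < γ) (hγ1 : γ < 1) :
    HasSum (fun n : ℕ => (n : ℝ) * gcMass b γ 1 n) (critDensity b γ) := by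
  have := (summable_pow_mul_gcMass_one hb hγ0 hγ1 1)
  simp only [pow_one] at this
  exact this.hasSum

lemma hasSum_sub_mul_gcMass_one (hb : 0 < b) (hγ0 : 0 < γ) (hγ1 : γ < 1) :
    HasSum (fun n : ℕ => gcMass b γ 1 n * ((n : ℝ) - critDensity b γ)) 0 := by
  have h := (hasSum_mul_gcMass_one hb hγ0 hγ1).sub
    ((hasSum_gcMass_one hb hγ0 hγ1).mul_left (critDensity b γ))
  rw [mul_one, sub_self] at h
  exact h.congr_fun fun n => by ring

lemma hasSum_sq_sub_mul_gcMass_one (hb : 0 < b) (hγ0 : 0 < γ) (hγ1 : γ < 1) :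
    HasSum (fun n : ℕ => gcMass b γ 1 n * ((n : ℝ) - critDensity b γ) ^ 2)
      (critVariance b γ) := by
  have h := ((summable_pow_mul_gcMass_one hb hγ0 hγ1 2).hasSum.sub
    ((hasSum_mul_gcMass_one hb hγ0 hγ1).mul_left (2 * critDensity b γ))).add
    ((hasSum_gcMass_one hb hγ0 hγ1).mul_left (critDensity b γ ^ 2))
  have e : critVariance b γ = (∑' k : ℕ, (k : ℝ) ^ 2 * gcMass b γ 1 k)
      - 2 * critDensity b γ * critDensity b γ + critDensity b γ ^ 2 * 1 := by
    rw [critVariance]; ring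
  rw [e]
  exact h.congr_fun fun n => by ring

lemma critDensity_nonneg (hb : 0 < b) (hγ0 : 0 < γ) (hγ1 : γ < 1) : 0 ≤ critDensity b γ :=
  (hasSum_mul_gcMass_one hb hγ0 hγ1).nonneg fun n =>
    mul_nonneg n.cast_nonneg (gcMass_one_pos hb hγ0 hγ1 n).le

lemma critVariance_pos (hb : 0 < b) (hγ0 : 0 < γ) (hγ1 : γ < 1) : 0 < critVariance b γ := by
  have h := hasSum_sq_sub_mul_gcMass_one hb hγ0 hγ1
  have hν := gcMass_one_pos hb hγ0 hγ1
  have hnn : ∀ n : ℕ, 0 ≤ gcMass b γ 1 n * ((n : ℝ) - critDensity b γ) ^ 2 := fun n =>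
    mul_nonneg (hν n).le (sq_nonneg _)
  -- the two atoms `0` and `1` cannot both sit at the mean
  by_cases h0 : critDensity b γ = 0
  · rw [← h.tsum_eq]
    refine h.summable.tsum_pos hnn 1 (mul_pos (hν 1) ?_)
    simp [h0]
  · rw [← h.tsum_eq]
    refine h.summable.tsum_pos hnn 0 (mul_pos (hν 0) ?_)
    have : 0 < critDensity b γ ^ 2 := by positivity
    simpa using this

lemma gcMass_one_antitone (hb : 0 < b) (hγ0 : 0 < γ) (hγ1 : γ < 1) :
    Antitone (gcMass b γ 1) := fun m n h => by
  rw [gcMass_one, gcMass_one]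
  exact div_le_div_of_nonneg_right (weight_antitone hb h) (siteZ_one_pos hb hγ0 hγ1).le

lemma tendsto_log_gcMass_one (hb : 0 < b) (hγ0 : 0 < γ) (hγ1 : γ < 1) :
    Tendsto (fun n : ℕ => Real.log (gcMass b γ 1 n) / (n : ℝ) ^ (1 - γ)) atTop
      (𝓝 (-(b / (1 - γ)))) := by
  have h1 : Tendsto (fun n : ℕ => Real.log (siteZ b γ 1) / (n : ℝ) ^ (1 - γ)) atTop (𝓝 0) :=
    tendsto_const_nhds.div_atTop
      ((tendsto_rpow_atTop (by linarith)).comp tendsto_natCast_atTop_atTop)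
  have h2 := (tendsto_log_weight hb hγ0 hγ1).sub h1
  rw [sub_zero] at h2
  refine h2.congr fun n => ?_
  rw [gcMass_one, Real.log_div (weight_pos hb n).ne' (siteZ_one_pos hb hγ0 hγ1).ne', sub_div]

lemma summable_gcMass_one_mul_exp (hb : 0 < b) (hγ0 : 0 < γ) (hγ1 : γ < 1) {c' : ℝ}
    (hc' : c' < b / (1 - γ)) (p : ℕ) :
    Summable fun n : ℕ =>
      gcMass b γ 1 n * ((1 + (n : ℝ)) ^ p * Real.exp (c' * (n : ℝ) ^ (1 - γ))) := by
  refine ((summable_weight_mul_exp hb hγ0 hγ1 hc' p).div_const (siteZ b γ 1)).congr fun n => ?_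
  rw [gcMass_one]; ring

end CriticalMeasure

/-! ### Exponential moments at vanishing parameter -/

section ExponentialMoments

lemma abs_exp_sub_one_sub_id_le (y : ℝ) :
    |Real.exp y - 1 - y| ≤ y ^ 2 * Real.exp |y| := by
  have h := Complex.norm_exp_sub_sum_le_norm_mul_exp (y : ℂ) 2
  have e : Complex.exp (y : ℂ) - ∑ m ∈ Finset.range 2, (y : ℂ) ^ m / (m.factorial : ℂ)
      = ((Real.exp y - 1 - y : ℝ) : ℂ) := by
    simp [Finset.sum_range_succ]; ring
  rw [e, Complex.norm_real, Complex.norm_real, Real.norm_eq_abs, Real.norm_eq_abs, sq_abs] at h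
  exact h

lemma abs_exp_sub_quadratic_le (y : ℝ) :
    |Real.exp y - 1 - y - y ^ 2 / 2| ≤ |y| ^ 3 * Real.exp |y| := by
  have h := Complex.norm_exp_sub_sum_le_norm_mul_exp (y : ℂ) 3
  have e : Complex.exp (y : ℂ) - ∑ m ∈ Finset.range 3, (y : ℂ) ^ m / (m.factorial : ℂ)
      = ((Real.exp y - 1 - y - y ^ 2 / 2 : ℝ) : ℂ) := by
    simp [Finset.sum_range_succ]; ring
  rw [e, Complex.norm_real, Complex.norm_real, Real.norm_eq_abs, Real.norm_eq_abs] at h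
  exact h

lemma tendsto_exp_second_order (a : ℝ) :
    Tendsto (fun s : ℝ => (s ^ 2)⁻¹ * (Real.exp (a * s) - 1 - a * s)) (𝓝[>] 0)
      (𝓝 (a ^ 2 / 2)) := by
  rw [tendsto_iff_norm_sub_tendsto_zero]
  have hlim : Tendsto (fun s : ℝ => |a| ^ 3 * |s| * Real.exp |a * s|) (𝓝[>] 0) (𝓝 0) := by
    have : ContinuousAt (fun s : ℝ => |a| ^ 3 * |s| * Real.exp |a * s|) 0 := by fun_prop
    have h := this.tendsto
    simp only [abs_zero, mul_zero, zero_mul] at h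
    exact h.mono_left nhdsWithin_le_nhds
  refine squeeze_zero' (Eventually.of_forall fun s => norm_nonneg _) ?_ hlim
  filter_upwards [self_mem_nhdsWithin] with s hs
  have hs : 0 < s := hs
  have e : (s ^ 2)⁻¹ * (Real.exp (a * s) - 1 - a * s) - a ^ 2 / 2
      = (s ^ 2)⁻¹ * (Real.exp (a * s) - 1 - a * s - (a * s) ^ 2 / 2) := by
    field_simp
  rw [e, Real.norm_eq_abs, abs_mul, abs_of_pos (by positivity : 0 < (s ^ 2)⁻¹)]
  calc _ ≤ (s ^ 2)⁻¹ * (|a * s| ^ 3 * Real.exp |a * s|) := by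
        gcongr; exact abs_exp_sub_quadratic_le _
    _ = _ := by
        rw [abs_mul, abs_of_pos hs]; field_simp

variable {b γ : ℝ}

/-- A linear exponent at rate `t ℓ^(-γ)` is dominated by a stretched exponential as long as the
occupation number stays below `κ ℓ`. -/
lemma linear_exponent_le (hγ0 : 0 < γ) {t κ c' : ℝ} (hκ : 0 < κ)
    (htκ : |t| * κ ^ γ ≤ c') {ℓ x : ℝ} (hℓ : 0 < ℓ) (hx0 : 0 ≤ x) (hx : x ≤ κ * ℓ) :
    |t| * ℓ ^ (-γ) * x ≤ c' * x ^ (1 - γ) := by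
  rcases hx0.eq_or_lt with rfl | hx0
  · rw [mul_zero]
    have : 0 ≤ c' := le_trans (by positivity) htκ
    positivity
  have h1 : x ^ γ ≤ κ ^ γ * ℓ ^ γ := by
    rw [← Real.mul_rpow hκ.le hℓ.le]
    exact Real.rpow_le_rpow hx0.le hx hγ0.le
  have h2 : x = x ^ γ * x ^ (1 - γ) := by
    rw [← Real.rpow_add hx0]; simp
  have hℓ' : 0 < ℓ ^ γ := by positivity
  have h3 : ℓ ^ (-γ) * x ≤ κ ^ γ * x ^ (1 - γ) := by
    rw [Real.rpow_neg hℓ.le, inv_mul_le_iff₀ hℓ']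
    calc x = x ^ γ * x ^ (1 - γ) := h2
      _ ≤ κ ^ γ * ℓ ^ γ * x ^ (1 - γ) := by gcongr
      _ = _ := by ring
  calc |t| * ℓ ^ (-γ) * x = |t| * (ℓ ^ (-γ) * x) := by ring
    _ ≤ |t| * (κ ^ γ * x ^ (1 - γ)) := by gcongr
    _ = |t| * κ ^ γ * x ^ (1 - γ) := by ring
    _ ≤ _ := by gcongr

/-- `E` is the exponential tilt with parameter `t ℓ^(-γ)` for occupation numbers up to `κ ℓ`, and
is nonnegative and dominated by the stretched exponential of rate `c'` beyond. The tilt is centred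
at the critical density. -/
structure IsModerateTilt (b γ t κ c' : ℝ) (E : ℝ → ℕ → ℝ) : Prop where
  eq_exp : ∀ ℓ (x : ℕ), (x : ℝ) ≤ κ * ℓ →
    E ℓ x = Real.exp (t * ℓ ^ (-γ) * (x - critDensity b γ))
  nonneg : ∀ ℓ x, 0 ≤ E ℓ x
  le_exp : ∀ ℓ (x : ℕ), κ * ℓ < x → E ℓ x ≤ Real.exp (c' * (x : ℝ) ^ (1 - γ))

variable {t κ c' : ℝ} {E : ℝ → ℕ → ℝ}

lemma IsModerateTilt.exists_bound (hE : IsModerateTilt b γ t κ c' E) (hb : 0 < b) (hγ0 : 0 < γ)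
    (hγ1 : γ < 1) (hκ : 0 < κ) (htκ : |t| * κ ^ γ ≤ c') :
    ∃ A : ℝ, ∀ ℓ, 1 ≤ ℓ → ∀ x : ℕ,
      ℓ ^ (2 * γ) * |E ℓ x - 1 - t * ℓ ^ (-γ) * (x - critDensity b γ)|
        ≤ A * ((1 + (x : ℝ)) ^ 3 * Real.exp (c' * (x : ℝ) ^ (1 - γ))) := by
  set ρ := critDensity b γ with hρdef
  have hρ : 0 ≤ ρ := critDensity_nonneg hb hγ0 hγ1
  have hc' : 0 ≤ c' := le_trans (by positivity) htκ
  refine ⟨t ^ 2 * (1 + ρ) ^ 2 * Real.exp (|t| * ρ) + (1 + κ⁻¹) ^ 2 * (2 + |t| * (1 + ρ)),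
    fun ℓ hℓ x => ?_⟩
  have hℓ0 : 0 < ℓ := by linarith
  have hx0 : (0 : ℝ) ≤ x := x.cast_nonneg
  have hs1 : ℓ ^ (-γ) ≤ 1 := Real.rpow_le_one_of_one_le_of_nonpos hℓ (by linarith)
  have hs0 : 0 < ℓ ^ (-γ) := by positivity
  have hexp1 : 1 ≤ Real.exp (c' * (x : ℝ) ^ (1 - γ)) := Real.one_le_exp (by positivity)
  have habs : |(x : ℝ) - ρ| ≤ x + ρ := by
    rw [abs_le]; constructor <;> linarith
  have hy : |t * ℓ ^ (-γ) * (x - ρ)| ≤ |t| * ℓ ^ (-γ) * x + |t| * ρ := by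
    rw [abs_mul, abs_mul, abs_of_pos hs0]
    calc |t| * ℓ ^ (-γ) * |x - ρ| ≤ |t| * ℓ ^ (-γ) * (x + ρ) := by gcongr
      _ = |t| * ℓ ^ (-γ) * x + |t| * ℓ ^ (-γ) * ρ := by ring
      _ ≤ |t| * ℓ ^ (-γ) * x + |t| * 1 * ρ := by gcongr
      _ = _ := by ring
  rw [add_mul]
  rcases le_or_gt (x : ℝ) (κ * ℓ) with hx | hx
  · refine le_add_of_le_of_nonneg ?_ (by positivity)
    rw [hE.eq_exp ℓ x hx]
    have h1 := linear_exponent_le hγ0 hκ htκ hℓ0 hx0 hx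
    have hsq : (x - ρ) ^ 2 ≤ (1 + ρ) ^ 2 * (1 + x) ^ 3 := by
      calc (x - ρ) ^ 2 = |x - ρ| ^ 2 := (sq_abs _).symm
        _ ≤ ((1 + ρ) * (1 + x)) ^ 2 := by
            gcongr
            nlinarith [mul_nonneg hρ hx0]
        _ = (1 + ρ) ^ 2 * (1 + x) ^ 2 := by ring
        _ ≤ _ := by
            gcongr
            · linarith
            · norm_num
    have hs2 : ℓ ^ (2 * γ) * (ℓ ^ (-γ)) ^ 2 = 1 := by
      rw [← Real.rpow_natCast, ← Real.rpow_mul hℓ0.le, ← Real.rpow_add hℓ0]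
      norm_num
      ring_nf
      simp
    calc _ ≤ ℓ ^ (2 * γ) * ((t * ℓ ^ (-γ) * (x - ρ)) ^ 2
          * Real.exp |t * ℓ ^ (-γ) * (x - ρ)|) := by
            gcongr; exact abs_exp_sub_one_sub_id_le _
      _ = t ^ 2 * (x - ρ) ^ 2 * Real.exp |t * ℓ ^ (-γ) * (x - ρ)| := by
            calc _ = (ℓ ^ (2 * γ) * (ℓ ^ (-γ)) ^ 2) * (t ^ 2 * (x - ρ) ^ 2
                  * Real.exp |t * ℓ ^ (-γ) * (x - ρ)|) := by ring
              _ = _ := by rw [hs2, one_mul]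
      _ ≤ t ^ 2 * ((1 + ρ) ^ 2 * (1 + x) ^ 3)
          * Real.exp (c' * (x : ℝ) ^ (1 - γ) + |t| * ρ) := by
            gcongr
            linarith
      _ = _ := by rw [Real.exp_add]; ring
  · refine le_add_of_nonneg_of_le (by positivity) ?_
    have h1 : |E ℓ x - 1 - t * ℓ ^ (-γ) * (x - ρ)|
        ≤ Real.exp (c' * (x : ℝ) ^ (1 - γ)) + 1 + (|t| * x + |t| * ρ) := by
      refine (abs_sub _ _).trans (add_le_add ?_ (hy.trans ?_))
      · refine (abs_sub _ _).trans ?_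
        rw [abs_one, abs_of_nonneg (hE.nonneg ℓ x)]
        linarith [hE.le_exp ℓ x hx]
      · have : |t| * ℓ ^ (-γ) * x ≤ |t| * 1 * x := by gcongr
        linarith
    have h2 : Real.exp (c' * (x : ℝ) ^ (1 - γ)) + 1 + (|t| * x + |t| * ρ)
        ≤ (2 + |t| * (1 + ρ)) * (1 + x) * Real.exp (c' * (x : ℝ) ^ (1 - γ)) := by
      set e := Real.exp (c' * (x : ℝ) ^ (1 - γ))
      have ht := abs_nonneg t
      have : 1 + (|t| * x + |t| * ρ) ≤ (1 + (|t| * x + |t| * ρ)) * e :=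
        le_mul_of_one_le_right (by positivity) hexp1
      have h3 : (2 + (|t| * x + |t| * ρ)) ≤ (2 + |t| * (1 + ρ)) * (1 + x) := by
        nlinarith [mul_nonneg ht hρ, mul_nonneg ht hx0, mul_nonneg (mul_nonneg ht hρ) hx0]
      nlinarith
    have h3 : ℓ ^ (2 * γ) ≤ (1 + κ⁻¹) ^ 2 * (1 + x) ^ 2 := by
      have hle : ℓ ≤ κ⁻¹ * x := by rw [le_inv_mul_iff₀ hκ]; exact hx.le
      calc ℓ ^ (2 * γ) ≤ ℓ ^ (2 : ℝ) := Real.rpow_le_rpow_of_exponent_le hℓ (by linarith)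
        _ = ℓ ^ 2 := by norm_cast
        _ ≤ ((1 + κ⁻¹) * (1 + x)) ^ 2 := by
            gcongr
            have : 0 < κ⁻¹ := by positivity
            nlinarith
        _ = _ := by ring
    calc _ ≤ ((1 + κ⁻¹) ^ 2 * (1 + x) ^ 2)
          * ((2 + |t| * (1 + ρ)) * (1 + x) * Real.exp (c' * (x : ℝ) ^ (1 - γ))) := by
            gcongr; exact h1.trans h2
      _ = _ := by ring

/-- Summability of the tilted measure, and the second order expansion of its total mass. The
hypothesis `|t| κ^γ ≤ c' < b / (1-γ)` provides a dominating function, so that the quadratic Taylor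
expansion may be summed term by term; the first order term vanishes because the exponent is
centred. -/
lemma IsModerateTilt.summable_and_tendsto (hE : IsModerateTilt b γ t κ c' E) (hb : 0 < b)
    (hγ0 : 0 < γ) (hγ1 : γ < 1) (hκ : 0 < κ) (htκ : |t| * κ ^ γ ≤ c')
    (hc' : c' < b / (1 - γ)) :
    (∀ ℓ, 1 ≤ ℓ → Summable fun x => gcMass b γ 1 x * E ℓ x) ∧
    Tendsto (fun ℓ : ℝ => ℓ ^ (2 * γ) * (∑' x, gcMass b γ 1 x * E ℓ x - 1)) atTop
      (𝓝 (t ^ 2 * critVariance b γ / 2)) := by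
  obtain ⟨A, hA⟩ := hE.exists_bound hb hγ0 hγ1 hκ htκ
  set ρ := critDensity b γ with hρdef
  have hν := gcMass_one_pos hb hγ0 hγ1
  set F : ℝ → ℕ → ℝ := fun ℓ x =>
    gcMass b γ 1 x * (ℓ ^ (2 * γ) * (E ℓ x - 1 - t * ℓ ^ (-γ) * (x - ρ))) with hF
  have hBsum : Summable fun x : ℕ =>
      A * (gcMass b γ 1 x * ((1 + (x : ℝ)) ^ 3 * Real.exp (c' * (x : ℝ) ^ (1 - γ)))) :=
    (summable_gcMass_one_mul_exp hb hγ0 hγ1 hc' 3).mul_left A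
  have hFB : ∀ ℓ, 1 ≤ ℓ → ∀ x, ‖F ℓ x‖
      ≤ A * (gcMass b γ 1 x * ((1 + (x : ℝ)) ^ 3 * Real.exp (c' * (x : ℝ) ^ (1 - γ)))) := by
    intro ℓ hℓ x
    rw [hF, Real.norm_eq_abs, abs_mul, abs_of_pos (hν x), abs_mul,
      abs_of_nonneg (Real.rpow_nonneg (by linarith) _)]
    calc _ ≤ gcMass b γ 1 x
          * (A * ((1 + (x : ℝ)) ^ 3 * Real.exp (c' * (x : ℝ) ^ (1 - γ)))) :=
        mul_le_mul_of_nonneg_left (hA ℓ hℓ x) (hν x).le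
      _ = _ := by ring
  have hFsum : ∀ ℓ, 1 ≤ ℓ → Summable (F ℓ) := fun ℓ hℓ =>
    Summable.of_norm_bounded hBsum (hFB ℓ hℓ)
  have hsum : ∀ ℓ, 1 ≤ ℓ → HasSum (fun x => gcMass b γ 1 x * E ℓ x)
      ((ℓ ^ (2 * γ))⁻¹ * (∑' x, F ℓ x) + 1) := by
    intro ℓ hℓ
    have hℓ' : ℓ ^ (2 * γ) ≠ 0 := (Real.rpow_pos_of_pos (by linarith) _).ne'
    have h := (((hFsum ℓ hℓ).hasSum.mul_left (ℓ ^ (2 * γ))⁻¹).add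
      (hasSum_gcMass_one hb hγ0 hγ1)).add
      ((hasSum_sub_mul_gcMass_one hb hγ0 hγ1).mul_left (t * ℓ ^ (-γ)))
    rw [mul_zero, add_zero] at h
    refine h.congr_fun fun x => ?_
    simp only [hF]
    field_simp
    ring
  refine ⟨fun ℓ hℓ => (hsum ℓ hℓ).summable, ?_⟩
  have hpt : ∀ x : ℕ, Tendsto (fun ℓ => F ℓ x) atTop
      (𝓝 (gcMass b γ 1 x * ((t * (x - ρ)) ^ 2 / 2))) := by
    intro x
    refine Tendsto.const_mul _ ?_
    have hs : Tendsto (fun ℓ : ℝ => ℓ ^ (-γ)) atTop (𝓝[>] 0) :=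
      tendsto_nhdsWithin_iff.2 ⟨tendsto_rpow_neg_atTop hγ0,
        (eventually_gt_atTop 0).mono fun ℓ hℓ => Real.rpow_pos_of_pos hℓ _⟩
    refine ((tendsto_exp_second_order (t * (x - ρ))).comp hs).congr' ?_
    filter_upwards [eventually_gt_atTop 0, eventually_ge_atTop (κ⁻¹ * x)] with ℓ hℓ hx
    rw [inv_mul_le_iff₀ hκ] at hx
    rw [hE.eq_exp ℓ x hx]
    have e1 : ((ℓ ^ (-γ)) ^ 2)⁻¹ = ℓ ^ (2 * γ) := by
      rw [← Real.rpow_natCast, ← Real.rpow_mul hℓ.le, ← Real.rpow_neg hℓ.le]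
      congr 1; push_cast; ring
    simp only [Function.comp, e1]
    rw [show t * (x - ρ) * ℓ ^ (-γ) = t * ℓ ^ (-γ) * (x - ρ) by ring]
  have hlim := tendsto_tsum_of_dominated_convergence hBsum hpt
    ((eventually_ge_atTop 1).mono fun ℓ hℓ => hFB ℓ hℓ)
  have hval : ∑' x : ℕ, gcMass b γ 1 x * ((t * (x - ρ)) ^ 2 / 2)
      = t ^ 2 * critVariance b γ / 2 := by
    have h := (hasSum_sq_sub_mul_gcMass_one hb hγ0 hγ1).mul_left (t ^ 2 / 2)
    rw [show t ^ 2 * critVariance b γ / 2 = t ^ 2 / 2 * critVariance b γ by ring, ← h.tsum_eq]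
    refine tsum_congr fun x => ?_
    ring
  rw [hval] at hlim
  refine hlim.congr' ?_
  filter_upwards [eventually_ge_atTop 1] with ℓ hℓ
  have hℓ' : ℓ ^ (2 * γ) ≠ 0 := (Real.rpow_pos_of_pos (by linarith) _).ne'
  rw [(hsum ℓ hℓ).tsum_eq]
  field_simp
  ring

/-- Logarithmic form of the expansion of the total mass of a tilted measure. -/
lemma IsModerateTilt.tendsto_log (hE : IsModerateTilt b γ t κ c' E) (hb : 0 < b)
    (hγ0 : 0 < γ) (hγ1 : γ < 1) (hκ : 0 < κ) (htκ : |t| * κ ^ γ ≤ c')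
    (hc' : c' < b / (1 - γ)) :
    (∀ᶠ ℓ : ℝ in atTop, 0 < ∑' x, gcMass b γ 1 x * E ℓ x) ∧
    Tendsto (fun ℓ : ℝ => ℓ ^ (2 * γ) * Real.log (∑' x, gcMass b γ 1 x * E ℓ x)) atTop
      (𝓝 (t ^ 2 * critVariance b γ / 2)) := by
  have hlim := (hE.summable_and_tendsto hb hγ0 hγ1 hκ htκ hc').2
  set Z : ℝ → ℝ := fun ℓ => ∑' x, gcMass b γ 1 x * E ℓ x with hZ
  have hZ1 : Tendsto Z atTop (𝓝 1) := by
    have h0 : Tendsto (fun ℓ : ℝ => ℓ ^ (-(2 * γ))) atTop (𝓝 0) :=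
      tendsto_rpow_neg_atTop (by linarith)
    have h := (h0.mul hlim).add_const 1
    rw [zero_mul, zero_add] at h
    refine h.congr' ?_
    filter_upwards [eventually_gt_atTop 0] with ℓ hℓ
    rw [← mul_assoc, ← Real.rpow_add hℓ]
    simp [hZ]
  have hpos : ∀ᶠ ℓ in atTop, 0 < Z ℓ := hZ1.eventually_const_lt one_pos
  refine ⟨hpos, ?_⟩
  have hlow : Tendsto (fun ℓ => ℓ ^ (2 * γ) * (Z ℓ - 1) * (Z ℓ)⁻¹) atTop
      (𝓝 (t ^ 2 * critVariance b γ / 2)) := by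
    simpa using hlim.mul (hZ1.inv₀ one_ne_zero)
  refine tendsto_of_tendsto_of_tendsto_of_le_of_le' hlow hlim ?_ ?_
  · filter_upwards [hpos, eventually_gt_atTop 0] with ℓ h hℓ
    rw [mul_assoc]
    gcongr
    have := Real.one_sub_inv_le_log_of_pos h
    rwa [sub_mul, mul_inv_cancel₀ h.ne', one_mul]
  · filter_upwards [hpos, eventually_gt_atTop 0] with ℓ h hℓ
    gcongr
    exact Real.log_le_sub_one_of_pos h

end ExponentialMoments

/-! ### Scale of the excess and large deviation speed -/

section Scales

/-- The order `L^(1/(1+γ))` of the particle excess and of the condensate. -/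
noncomputable def scale (γ : ℝ) (L : ℕ) : ℝ := (L : ℝ) ^ (1 / (1 + γ))

/-- The large deviation speed `scale^(1-γ) = scale² / L`, at which moderate deviations of the bulk
and a single large occupation number have comparable cost. -/
noncomputable def speed (γ : ℝ) (L : ℕ) : ℝ := scale γ L ^ (1 - γ)

variable {γ : ℝ}

lemma scale_pos {L : ℕ} (hL : 0 < L) : 0 < scale γ L :=
  Real.rpow_pos_of_pos (by exact_mod_cast hL) _

lemma speed_pos {L : ℕ} (hL : 0 < L) : 0 < speed γ L := Real.rpow_pos_of_pos (scale_pos hL) _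

lemma tendsto_scale (hγ0 : 0 < γ) : Tendsto (scale γ) atTop atTop :=
  (tendsto_rpow_atTop (by positivity)).comp tendsto_natCast_atTop_atTop

lemma tendsto_speed (hγ0 : 0 < γ) (hγ1 : γ < 1) : Tendsto (speed γ) atTop atTop :=
  (tendsto_rpow_atTop (by linarith)).comp (tendsto_scale hγ0)

lemma scale_rpow_one_add (hγ0 : 0 < γ) (L : ℕ) : scale γ L ^ (1 + γ) = L := by
  rw [scale, ← Real.rpow_mul (by positivity), one_div, inv_mul_cancel₀ (by linarith),
    Real.rpow_one]

lemma speed_mul_scale_rpow (hγ0 : 0 < γ) {L : ℕ} (hL : 0 < L) :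
    speed γ L * scale γ L ^ (2 * γ) = L := by
  rw [← scale_rpow_one_add hγ0 L, speed, ← Real.rpow_add (scale_pos hL)]
  ring_nf

lemma scale_rpow_neg_mul {L : ℕ} (hL : 0 < L) (y : ℝ) :
    scale γ L ^ (-γ) * y = speed γ L * (y / scale γ L) := by
  have h := scale_pos (γ := γ) hL
  rw [speed, show 1 - γ = -γ + 1 by ring, Real.rpow_add_one h.ne']
  field_simp

lemma eventually_natCast_le_exp_speed (hγ0 : 0 < γ) (hγ1 : γ < 1) {e : ℝ} (he : 0 < e) :
    ∀ᶠ L : ℕ in atTop, (L : ℝ) ≤ Real.exp (speed γ L * e) := by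
  have h := (isLittleO_exp_neg_mul_rpow_atTop he (-((1 + γ) / (1 - γ)))).comp_tendsto
    (tendsto_speed hγ0 hγ1)
  filter_upwards [h.bound one_pos, eventually_gt_atTop 0] with L hL hL0
  have hs := speed_pos (γ := γ) hL0
  have h1γ : 1 - γ ≠ 0 := by linarith
  simp only [Function.comp] at hL
  have e1 : speed γ L ^ ((1 + γ) / (1 - γ)) = L := by
    rw [speed, ← Real.rpow_mul (scale_pos hL0).le, mul_div_cancel₀ _ h1γ, scale_rpow_one_add hγ0]
  rw [Real.norm_of_nonneg (Real.exp_pos _).le, Real.norm_of_nonneg (by positivity), one_mul,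
    Real.rpow_neg hs.le, e1, neg_mul, Real.exp_neg] at hL
  rw [mul_comm]
  exact (inv_le_inv₀ (Real.exp_pos _) (by exact_mod_cast hL0)).1 hL

variable {b : ℝ}

lemma tendsto_log_gcMass_scale (hb : 0 < b) (hγ0 : 0 < γ) (hγ1 : γ < 1) {v : ℝ} (hv : 0 < v)
    {m : ℕ → ℕ} (hm : Tendsto (fun L => (m L : ℝ) / scale γ L) atTop (𝓝 v)) :
    Tendsto (fun L => Real.log (gcMass b γ 1 (m L)) / speed γ L) atTop
      (𝓝 (-(b / (1 - γ) * v ^ (1 - γ)))) := by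
  have hmtop : Tendsto m atTop atTop := by
    rw [← tendsto_natCast_atTop_iff (R := ℝ)]
    refine (hm.pos_mul_atTop hv (tendsto_scale hγ0)).congr' ?_
    filter_upwards [eventually_gt_atTop 0] with L hL
    exact div_mul_cancel₀ _ (scale_pos hL).ne'
  have h := ((tendsto_log_gcMass_one hb hγ0 hγ1).comp hmtop).mul
    (hm.rpow_const (p := 1 - γ) (Or.inl hv.ne'))
  rw [neg_mul] at h
  refine h.congr' ?_
  filter_upwards [eventually_gt_atTop 0, hmtop.eventually_gt_atTop 0] with L hL hmL
  have h1 : ((m L : ℕ) : ℝ) ^ (1 - γ) ≠ 0 := (Real.rpow_pos_of_pos (by exact_mod_cast hmL) _).ne'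
  have h2 := (speed_pos (γ := γ) hL).ne'
  rw [Real.div_rpow (by positivity) (scale_pos hL).le, ← speed]
  simp only [Function.comp]
  field_simp

end Scales

/-! ### Total mass of tilted product measures -/

section TiltedMass

variable {b γ t κ c' : ℝ} {E : ℝ → ℕ → ℝ}

/-- Powers of the mass of a tilted measure, for a number `n L ∼ L` of sites. -/
lemma IsModerateTilt.eventually_pow (hE : IsModerateTilt b γ t κ c' E) (hb : 0 < b)
    (hγ0 : 0 < γ) (hγ1 : γ < 1) (hκ : 0 < κ) (htκ : |t| * κ ^ γ ≤ c')
    (hc' : c' < b / (1 - γ)) {n : ℕ → ℕ}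
    (hn : Tendsto (fun L => (n L : ℝ) / L) atTop (𝓝 1)) {e : ℝ} (he : 0 < e) :
    ∀ᶠ L : ℕ in atTop,
      Real.exp (speed γ L * (t ^ 2 * critVariance b γ / 2 - e))
        ≤ (∑' x, gcMass b γ 1 x * E (scale γ L) x) ^ n L ∧
      (∑' x, gcMass b γ 1 x * E (scale γ L) x) ^ n L
        ≤ Real.exp (speed γ L * (t ^ 2 * critVariance b γ / 2 + e)) := by
  obtain ⟨hpos, hlim⟩ := hE.tendsto_log hb hγ0 hγ1 hκ htκ hc'
  have h := hn.mul (hlim.comp (tendsto_scale hγ0))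
  rw [one_mul] at h
  filter_upwards [h.eventually_const_lt (sub_lt_self _ he),
    h.eventually_lt_const (lt_add_of_pos_right _ he),
    (tendsto_scale hγ0).eventually hpos, eventually_gt_atTop 0] with L h1 h2 h3 hL
  have hs := speed_pos (γ := γ) hL
  set Z := ∑' x, gcMass b γ 1 x * E (scale γ L) x
  have e1 : (n L : ℝ) / L * (scale γ L ^ (2 * γ) * Real.log Z) * speed γ L
      = n L * Real.log Z := by
    have := speed_mul_scale_rpow hγ0 hL
    have hL' : (L : ℝ) ≠ 0 := by exact_mod_cast hL.ne'
    calc _ = (n L : ℝ) / L * (speed γ L * scale γ L ^ (2 * γ)) * Real.log Z := by ring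
      _ = _ := by rw [this, div_mul_cancel₀ _ hL']
  have e2 : Z ^ n L = Real.exp (n L * Real.log Z) := by
    rw [Real.exp_nat_mul, Real.exp_log h3]
  simp only [Function.comp] at h1 h2
  rw [e2, ← e1, mul_comm (speed γ L), mul_comm (speed γ L)]
  constructor
  · gcongr
  · gcongr

/-- The exponential tilt restricted to occupation numbers at most `κ ℓ`. -/
noncomputable def truncTilt (b γ t κ ℓ : ℝ) (x : ℕ) : ℝ :=
  if (x : ℝ) ≤ κ * ℓ then Real.exp (t * ℓ ^ (-γ) * (x - critDensity b γ)) else 0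

/-- The tilt that is exponential for occupation numbers up to `κ ℓ`, and a stretched exponential
for larger ones. -/
noncomputable def jumpTilt (b γ t κ c' ℓ : ℝ) (x : ℕ) : ℝ :=
  if (x : ℝ) ≤ κ * ℓ then Real.exp (t * ℓ ^ (-γ) * (x - critDensity b γ))
  else Real.exp (c' * (x : ℝ) ^ (1 - γ))

lemma isModerateTilt_truncTilt : IsModerateTilt b γ t κ c' (truncTilt b γ t κ) where
  eq_exp ℓ x hx := by rw [truncTilt, if_pos hx]
  nonneg ℓ x := by unfold truncTilt; split_ifs <;> positivity
  le_exp ℓ x hx := by rw [truncTilt, if_neg hx.not_ge]; positivity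

lemma isModerateTilt_jumpTilt : IsModerateTilt b γ t κ c' (jumpTilt b γ t κ c') where
  eq_exp ℓ x hx := by rw [jumpTilt, if_pos hx]
  nonneg ℓ x := by unfold jumpTilt; split_ifs <;> positivity
  le_exp ℓ x hx := by rw [jumpTilt, if_neg hx.not_ge]

lemma tsum_truncTilt {ℓ : ℝ} (hκℓ : 0 ≤ κ * ℓ) :
    ∑' x, gcMass b γ 1 x * truncTilt b γ t κ ℓ x
      = ∑ x ∈ Finset.range (⌊κ * ℓ⌋₊ + 1),
          gcMass b γ 1 x * Real.exp (t * ℓ ^ (-γ) * (x - critDensity b γ)) := by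
  rw [tsum_eq_sum (s := Finset.range (⌊κ * ℓ⌋₊ + 1))]
  · refine Finset.sum_congr rfl fun x hx => ?_
    rw [truncTilt, if_pos ((Nat.le_floor_iff hκℓ).1 (Finset.mem_range_succ_iff.1 hx))]
  · intro x hx
    rw [truncTilt, if_neg, mul_zero]
    exact fun h => hx (Finset.mem_range_succ_iff.2 ((Nat.le_floor_iff hκℓ).2 h))

end TiltedMass

/-! ### Lower bound for the particle number and the maximum -/

section LowerBound

variable {b γ : ℝ}

/-- Lower bound for the probability that `n L ∼ L` independent sites, with occupation numbers at
most `κ · scale`, have excess mass close to `a · scale`. Under the tilt of parameter `a / σ²` this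
event has probability tending to one; its complement is excluded by comparing with the tilts of
parameters `(a ± ε) / σ²`, so that only total masses of tilted measures enter. -/
lemma eventually_le_sum_window (hb : 0 < b) (hγ0 : 0 < γ) (hγ1 : γ < 1) {n : ℕ → ℕ}
    (hn : Tendsto (fun L => (n L : ℝ) / L) atTop (𝓝 1)) {a ε κ : ℝ} (hε : 0 < ε) (hκ : 0 < κ)
    (hκ' : (|a| + ε) / critVariance b γ * κ ^ γ < b / (1 - γ)) :
    ∀ᶠ L : ℕ in atTop,
      Real.exp (-(speed γ L * (a ^ 2 / (2 * critVariance b γ) + |a| * ε / critVariance b γ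
          + ε ^ 2 / (4 * critVariance b γ))))
        ≤ ∑ η ∈ Fintype.piFinset (fun _ : Fin (n L) => Finset.range (⌊κ * scale γ L⌋₊ + 1)) with
            |∑ i, ((η i : ℝ) - critDensity b γ) - a * scale γ L| ≤ ε * scale γ L,
          ∏ i, gcMass b γ 1 (η i) := by
  set ρ := critDensity b γ with hρ
  set σ2 := critVariance b γ with hσ
  have hσ0 : 0 < σ2 := critVariance_pos hb hγ0 hγ1
  have hν := gcMass_one_pos hb hγ0 hγ1
  set t := a / σ2 with ht
  set u := ε / σ2 with hu
  set e := ε ^ 2 / (8 * σ2) with he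
  have he0 : 0 < e := by positivity
  have hu0 : 0 < u := by positivity
  have hbd : ∀ s, |s| ≤ |t| + u → |s| * κ ^ γ ≤ (|a| + ε) / σ2 * κ ^ γ := by
    intro s hs
    have : |t| + u = (|a| + ε) / σ2 := by rw [ht, hu, abs_div, abs_of_pos hσ0, add_div]
    rw [← this]
    gcongr
  have key : ∀ s, |s| ≤ |t| + u → ∀ᶠ L : ℕ in atTop,
      Real.exp (speed γ L * (s ^ 2 * σ2 / 2 - e))
        ≤ (∑' x, gcMass b γ 1 x * truncTilt b γ s κ (scale γ L) x) ^ n L ∧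
      (∑' x, gcMass b γ 1 x * truncTilt b γ s κ (scale γ L) x) ^ n L
        ≤ Real.exp (speed γ L * (s ^ 2 * σ2 / 2 + e)) := fun s hs =>
    isModerateTilt_truncTilt.eventually_pow hb hγ0 hγ1 hκ (hbd s hs) hκ' hn he0
  have hexp2 : ∀ᶠ L : ℕ in atTop, 2 ≤ Real.exp (speed γ L * e) :=
    (Real.tendsto_exp_atTop.comp ((tendsto_speed hγ0 hγ1).atTop_mul_const he0)).eventually_ge_atTop 2
  filter_upwards [key t (by linarith), key (t + u) ((abs_add_le _ _).trans (by rw [abs_of_pos hu0])),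
    key (t - u) ((abs_sub _ _).trans (by rw [abs_of_pos hu0])), hexp2, eventually_gt_atTop 0]
    with L h1 h2 h3 hx hL
  have hℓ := scale_pos (γ := γ) hL
  set T := speed γ L with hT
  have hT0 : 0 < T := speed_pos hL
  set ℓ := scale γ L with hℓdef
  set P := Fintype.piFinset (fun _ : Fin (n L) => Finset.range (⌊κ * ℓ⌋₊ + 1)) with hP
  set Y : (Fin (n L) → ℕ) → ℝ := fun η => ∑ i, ((η i : ℝ) - ρ) with hY
  have hmass : ∀ s, (∑' x, gcMass b γ 1 x * truncTilt b γ s κ ℓ x) ^ n L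
      = ∑ η ∈ P, (∏ i, gcMass b γ 1 (η i)) * Real.exp (T * (s * (Y η / ℓ))) := by
    intro s
    rw [tsum_truncTilt (by positivity)]
    have := Finset.prod_univ_sum (fun _ : Fin (n L) => Finset.range (⌊κ * ℓ⌋₊ + 1))
      (fun _ x => gcMass b γ 1 x * Real.exp (s * ℓ ^ (-γ) * (x - ρ)))
    rw [Finset.prod_const, Finset.card_univ, Fintype.card_fin] at this
    rw [this]
    refine Finset.sum_congr rfl fun η _ => ?_
    rw [Finset.prod_mul_distrib, ← Real.exp_sum, ← Finset.mul_sum]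
    congr 2
    rw [mul_assoc, scale_rpow_neg_mul hL]
    ring
  rw [hmass] at h1 h2 h3
  set W : (Fin (n L) → ℕ) → Prop := fun η => |Y η - a * ℓ| ≤ ε * ℓ with hW
  change _ ≤ ∑ η ∈ P with W η, ∏ i, gcMass b γ 1 (η i)
  have hprod : ∀ η : Fin (n L) → ℕ, 0 ≤ ∏ i, gcMass b γ 1 (η i) := fun η =>
    Finset.prod_nonneg fun i _ => (hν _).le
  set A := t ^ 2 * σ2 / 2 with hA
  -- outside the window one of the tilts `t ± u` exceeds the tilt `t` by a factor that beats the
  -- growth of the total mass; `u = ε / σ²` is the optimal Chernoff parameter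
  have hout : ∑ η ∈ P with ¬ W η, (∏ i, gcMass b γ 1 (η i)) * Real.exp (T * (t * (Y η / ℓ)))
      ≤ 2 * Real.exp (T * (A - 3 * e)) := by
    have hpt : ∀ η, ¬ W η → Real.exp (T * (t * (Y η / ℓ)))
        ≤ Real.exp (-(T * (u * (a + ε)))) * Real.exp (T * ((t + u) * (Y η / ℓ)))
          + Real.exp (T * (u * (a - ε))) * Real.exp (T * ((t - u) * (Y η / ℓ))) := by
      intro η hη
      rw [← Real.exp_add, ← Real.exp_add]
      simp only [hW, not_le] at hη
      rcases lt_abs.1 hη with h | h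
      · refine le_add_of_le_of_nonneg (Real.exp_le_exp.2 ?_) (Real.exp_pos _).le
        have : a + ε ≤ Y η / ℓ := by rw [le_div_iff₀ hℓ]; linarith
        have := mul_le_mul_of_nonneg_left this (mul_nonneg hT0.le hu0.le)
        linarith
      · refine le_add_of_nonneg_of_le (Real.exp_pos _).le (Real.exp_le_exp.2 ?_)
        have : Y η / ℓ ≤ a - ε := by rw [div_le_iff₀ hℓ]; linarith
        have := mul_le_mul_of_nonneg_left this (mul_nonneg hT0.le hu0.le)
        linarith
    calc _ ≤ ∑ η ∈ P with ¬ W η, (∏ i, gcMass b γ 1 (η i))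
            * (Real.exp (-(T * (u * (a + ε)))) * Real.exp (T * ((t + u) * (Y η / ℓ)))
              + Real.exp (T * (u * (a - ε))) * Real.exp (T * ((t - u) * (Y η / ℓ)))) :=
          Finset.sum_le_sum fun η hη => mul_le_mul_of_nonneg_left
            (hpt η (Finset.mem_filter.1 hη).2) (hprod η)
      _ ≤ ∑ η ∈ P, (∏ i, gcMass b γ 1 (η i))
            * (Real.exp (-(T * (u * (a + ε)))) * Real.exp (T * ((t + u) * (Y η / ℓ)))
              + Real.exp (T * (u * (a - ε))) * Real.exp (T * ((t - u) * (Y η / ℓ)))) :=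
          Finset.sum_le_sum_of_subset_of_nonneg (Finset.filter_subset _ _)
            fun η _ _ => mul_nonneg (hprod η) (by positivity)
      _ = Real.exp (-(T * (u * (a + ε))))
            * (∑ η ∈ P, (∏ i, gcMass b γ 1 (η i)) * Real.exp (T * ((t + u) * (Y η / ℓ))))
          + Real.exp (T * (u * (a - ε)))
            * (∑ η ∈ P, (∏ i, gcMass b γ 1 (η i)) * Real.exp (T * ((t - u) * (Y η / ℓ)))) := by
          rw [Finset.mul_sum, Finset.mul_sum, ← Finset.sum_add_distrib]
          refine Finset.sum_congr rfl fun η _ => ?_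
          ring
      _ ≤ Real.exp (-(T * (u * (a + ε)))) * Real.exp (T * ((t + u) ^ 2 * σ2 / 2 + e))
          + Real.exp (T * (u * (a - ε))) * Real.exp (T * ((t - u) ^ 2 * σ2 / 2 + e)) := by
          gcongr
          · exact h2.2
          · exact h3.2
      _ = _ := by
          rw [← Real.exp_add, ← Real.exp_add]
          have e1 : -(T * (u * (a + ε))) + T * ((t + u) ^ 2 * σ2 / 2 + e) = T * (A - 3 * e) := by
            rw [hA, he, ht, hu]; field_simp; ring
          have e2 : T * (u * (a - ε)) + T * ((t - u) ^ 2 * σ2 / 2 + e) = T * (A - 3 * e) := by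
            rw [hA, he, ht, hu]; field_simp; ring
          rw [e1, e2]; ring
  have hin : Real.exp (T * (A - 2 * e))
      ≤ ∑ η ∈ P with W η, (∏ i, gcMass b γ 1 (η i)) * Real.exp (T * (t * (Y η / ℓ))) := by
    have hsplit := Finset.sum_filter_add_sum_filter_not P W
      (fun η => (∏ i, gcMass b γ 1 (η i)) * Real.exp (T * (t * (Y η / ℓ))))
    have hexp : Real.exp (T * (A - 2 * e)) + 2 * Real.exp (T * (A - 3 * e))
        ≤ Real.exp (T * (A - e)) := by
      have e1 : Real.exp (T * (A - e)) = Real.exp (T * (A - 3 * e)) * Real.exp (T * e) ^ 2 := by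
        rw [← Real.exp_nat_mul, ← Real.exp_add]; congr 1; push_cast; ring
      have e2 : Real.exp (T * (A - 2 * e)) = Real.exp (T * (A - 3 * e)) * Real.exp (T * e) := by
        rw [← Real.exp_add]; congr 1; ring
      rw [e1, e2]
      have := Real.exp_pos (T * (A - 3 * e))
      nlinarith [mul_nonneg this.le (mul_nonneg (sub_nonneg.2 hx)
        (by linarith : 0 ≤ Real.exp (T * e) + 1))]
    linarith [h1.1]
  have hW2 : ∀ η, W η → Real.exp (T * (t * (Y η / ℓ)))
      ≤ Real.exp (T * (t * a + |t| * ε)) := by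
    intro η hη
    have h4 : |Y η / ℓ - a| ≤ ε := by
      have : Y η / ℓ - a = (Y η - a * ℓ) / ℓ := by field_simp
      rw [this, abs_div, abs_of_pos hℓ, div_le_iff₀ hℓ]
      exact hη
    have h5 : t * (Y η / ℓ) - t * a ≤ |t| * ε := by
      rw [← mul_sub]
      exact (le_abs_self _).trans (by rw [abs_mul]; gcongr)
    gcongr
    linarith
  have hfin : Real.exp (T * (A - 2 * e))
      ≤ (∑ η ∈ P with W η, ∏ i, gcMass b γ 1 (η i)) * Real.exp (T * (t * a + |t| * ε)) := by
    refine hin.trans ?_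
    rw [Finset.sum_mul]
    exact Finset.sum_le_sum fun η hη => mul_le_mul_of_nonneg_left
      (hW2 η (Finset.mem_filter.1 hη).2) (hprod η)
  rw [← div_le_iff₀ (Real.exp_pos _), ← Real.exp_sub] at hfin
  refine le_trans (Real.exp_le_exp.2 (le_of_eq ?_)) hfin
  rw [hA, he, ht, abs_div, abs_of_pos hσ0]
  field_simp
  ring

lemma mem_configs {L N : ℕ} {η : Fin L → ℕ} : η ∈ configs L N ↔ ∑ x, η x = N := by
  simp [configs]

lemma le_maxOcc {L : ℕ} (η : Fin L → ℕ) (x : Fin L) : η x ≤ maxOcc η :=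
  Finset.le_sup (f := η) (Finset.mem_univ x)

/-- Configurations on `n` sites with occupation numbers at most `m` extend to configurations with
maximum `m`, by one site with `m` particles and one site absorbing the at most `D` remaining ones. -/
lemma mul_sum_le_sum_maxOcc {f : ℕ → ℝ} (hf : ∀ x, 0 ≤ f x) (hf' : Antitone f)
    {n N m D : ℕ} (hD : D ≤ m) (W : Finset (Fin n → ℕ)) (hWm : ∀ η ∈ W, ∀ i, η i ≤ m)
    (hWN : ∀ η ∈ W, m + ∑ i, η i ≤ N) (hWD : ∀ η ∈ W, N ≤ m + ∑ i, η i + D) :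
    f m * f D * ∑ η ∈ W, ∏ i, f (η i)
      ≤ ∑ η ∈ configs (n + 2) N with maxOcc η = m, ∏ i, f (η i) := by
  set Φ : (Fin n → ℕ) → (Fin (n + 2) → ℕ) := fun η =>
    Fin.cons m (Fin.cons (N - (m + ∑ i, η i)) η : Fin (n + 1) → ℕ) with hΦ
  have hinj : Set.InjOn Φ W := by
    intro η _ ξ _ h
    exact (Fin.cons_injective2 (Fin.cons_injective2 h).2).2
  have hmem : W.image Φ ⊆ (configs (n + 2) N).filter fun η => maxOcc η = m := by
    intro ζ hζ
    obtain ⟨η, hη, rfl⟩ := Finset.mem_image.1 hζ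
    have h1 := hWN η hη
    have h2 := hWD η hη
    refine Finset.mem_filter.2 ⟨mem_configs.2 ?_, le_antisymm ?_ ?_⟩
    · simp only [hΦ, Fin.sum_univ_succ, Fin.cons_zero, Fin.cons_succ]
      omega
    · refine Finset.sup_le fun i _ => ?_
      refine Fin.cases ?_ (fun j => ?_) i
      · simp [hΦ]
      · refine Fin.cases ?_ (fun k => ?_) j
        · simp only [hΦ, Fin.cons_succ, Fin.cons_zero]
          omega
        · simpa [hΦ] using hWm η hη k
    · exact le_maxOcc (Φ η) 0
  calc _ = ∑ η ∈ W, f m * f D * ∏ i, f (η i) := Finset.mul_sum _ _ _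
    _ ≤ ∑ η ∈ W, ∏ i, f (Φ η i) := by
        refine Finset.sum_le_sum fun η hη => ?_
        have h2 := hWD η hη
        simp only [hΦ, Fin.prod_univ_succ, Fin.cons_zero, Fin.cons_succ]
        rw [← mul_assoc]
        refine mul_le_mul_of_nonneg_right (mul_le_mul_of_nonneg_left (hf' ?_) (hf _))
          (Finset.prod_nonneg fun i _ => hf _)
        omega
    _ = ∑ η ∈ W.image Φ, ∏ i, f (η i) := 
        (Finset.sum_image (f := fun η => ∏ i, f (η i)) hinj).symm
    _ ≤ _ := Finset.sum_le_sum_of_subset_of_nonneg hmem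
        fun η _ _ => Finset.prod_nonneg fun i _ => hf _

/-- Lower bound for the joint probability of `N` particles and maximum `m`: one site carries `m`
particles, all but one of the others carry almost the whole remaining excess, and a single site
with `O(ε · scale)` particles, whose cost vanishes with `ε`, makes the particle number exact. -/
lemma eventually_le_sum_maxOcc (hb : 0 < b) (hγ0 : 0 < γ) (hγ1 : γ < 1) {r v : ℝ} (hv : 0 < v)
    {N m : ℕ → ℕ}
    (hN : Tendsto (fun L => ((N L : ℝ) - critDensity b γ * L) / scale γ L) atTop (𝓝 (r + v)))
    (hm : Tendsto (fun L => (m L : ℝ) / scale γ L) atTop (𝓝 v)) {e : ℝ} (he : 0 < e) :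
    ∀ᶠ L : ℕ in atTop,
      Real.exp (-(speed γ L
          * (r ^ 2 / (2 * critVariance b γ) + b / (1 - γ) * v ^ (1 - γ) + e)))
        ≤ ∑ η ∈ configs L (N L) with maxOcc η = m L, ∏ i, gcMass b γ 1 (η i) := by
  set ρ := critDensity b γ with hρ
  set σ2 := critVariance b γ with hσ
  set c := b / (1 - γ) with hc
  have h1γ : 0 < 1 - γ := by linarith
  have hc0 : 0 < c := div_pos hb h1γ
  have hσ0 : 0 < σ2 := critVariance_pos hb hγ0 hγ1
  have hν := gcMass_one_pos hb hγ0 hγ1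
  -- The window is centred at `r - 2ε`, so that between `0` and `4ε · scale` particles are left for
  -- the correcting site; the total cost is continuous at `ε = 0`, since `0 ^ (1 - γ) = 0`.
  obtain ⟨ε, hε0, hεv, hεG⟩ : ∃ ε, 0 < ε ∧ 4 * ε < v / 2 ∧
      c * (4 * ε) ^ (1 - γ) + ((r - 2 * ε) ^ 2 / (2 * σ2) + |r - 2 * ε| * ε / σ2
        + ε ^ 2 / (4 * σ2)) < r ^ 2 / (2 * σ2) + e / 3 := by
    have hcont : ContinuousAt (fun ε : ℝ => c * (4 * ε) ^ (1 - γ) + ((r - 2 * ε) ^ 2 / (2 * σ2)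
        + |r - 2 * ε| * ε / σ2 + ε ^ 2 / (4 * σ2))) 0 := by
      have h1 : ContinuousAt (fun ε : ℝ => (4 * ε) ^ (1 - γ)) 0 :=
        ContinuousAt.rpow_const (by fun_prop) (Or.inr h1γ.le)
      fun_prop
    have h := hcont.tendsto
    simp only [mul_zero, Real.zero_rpow h1γ.ne', sub_zero, zero_div, add_zero, ne_eq,
      OfNat.ofNat_ne_zero, not_false_eq_true, zero_pow, zero_add] at h
    have h4 : Tendsto (fun ε : ℝ => 4 * ε) (𝓝 0) (𝓝 0) := by
      have : ContinuousAt (fun ε : ℝ => 4 * ε) 0 := by fun_prop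
      simpa using this.tendsto
    obtain ⟨ε, ⟨h5, h6⟩, h7⟩ := (((h.eventually_lt_const (by linarith : r ^ 2 / (2 * σ2)
      < r ^ 2 / (2 * σ2) + e / 3)).and (h4.eventually_lt_const (half_pos hv))).filter_mono
      nhdsWithin_le_nhds |>.and (self_mem_nhdsWithin (s := Set.Ioi (0 : ℝ)))).exists
    exact ⟨ε, h7, h6, h5⟩
  obtain ⟨κ, hκ0, hκv, hκc⟩ : ∃ κ, 0 < κ ∧ κ < v / 2 ∧
      (|r - 2 * ε| + ε) / σ2 * κ ^ γ < c := by
    have hcont : ContinuousAt (fun κ : ℝ => (|r - 2 * ε| + ε) / σ2 * κ ^ γ) 0 :=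
      (ContinuousAt.rpow_const continuousAt_id (Or.inr hγ0.le)).const_mul _
    have h := hcont.tendsto
    simp only [Real.zero_rpow hγ0.ne', mul_zero] at h
    obtain ⟨κ, ⟨h5, h6⟩, h7⟩ := (((h.eventually_lt_const hc0).and
      (eventually_lt_nhds (half_pos hv))).filter_mono nhdsWithin_le_nhds |>.and
      (self_mem_nhdsWithin (s := Set.Ioi (0 : ℝ)))).exists
    exact ⟨κ, h7, h6, h5⟩
  have hscale := tendsto_scale hγ0
  have hn : Tendsto (fun L : ℕ => ((L - 2 : ℕ) : ℝ) / L) atTop (𝓝 1) := by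
    have h : Tendsto (fun L : ℕ => 1 - 2 / (L : ℝ)) atTop (𝓝 1) := by
      simpa using (tendsto_const_nhds.div_atTop
        (tendsto_natCast_atTop_atTop (R := ℝ)) : Tendsto (fun L : ℕ => 2 / (L : ℝ)) _ _).const_sub 1
    refine h.congr' ?_
    filter_upwards [eventually_ge_atTop 2] with L hL
    rw [Nat.cast_sub hL, sub_div, div_self (by positivity)]
    simp
  have hD : Tendsto (fun L => (⌊4 * ε * scale γ L⌋₊ : ℝ) / scale γ L) atTop (𝓝 (4 * ε)) :=
    (tendsto_nat_floor_mul_div_atTop (by positivity)).comp hscale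
  have hq : Tendsto (fun L : ℕ => ((N L : ℝ) - ρ * L) / scale γ L - m L / scale γ L
      + 2 * ρ / scale γ L) atTop (𝓝 r) := by
    have := (hN.sub hm).add (tendsto_const_nhds.div_atTop hscale :
      Tendsto (fun L => 2 * ρ / scale γ L) _ _)
    simpa using this
  filter_upwards [eventually_le_sum_window hb hγ0 hγ1 hn hε0 hκ0 hκc,
    (tendsto_log_gcMass_scale hb hγ0 hγ1 hv hm).eventually_const_lt
      (sub_lt_self _ (by positivity : 0 < e / 3)),
    (tendsto_log_gcMass_scale hb hγ0 hγ1 (by positivity) hD).eventually_const_lt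
      (sub_lt_self _ (by positivity : 0 < e / 3)),
    hm.eventually_const_lt (half_lt_self hv),
    hq.eventually_const_lt (sub_lt_self r hε0), hq.eventually_lt_const (lt_add_of_pos_right r hε0),
    eventually_ge_atTop 2] with L hwin hlm hlD hmv hq1 hq2 hL
  obtain ⟨n, rfl⟩ : ∃ n, L = n + 2 := ⟨L - 2, by omega⟩
  have hL0 : 0 < n + 2 := by omega
  have hℓ := scale_pos (γ := γ) hL0
  have hT := speed_pos (γ := γ) hL0
  set ℓ := scale γ (n + 2)
  set T := speed γ (n + 2)
  have hDm : ⌊4 * ε * ℓ⌋₊ ≤ m (n + 2) := by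
    refine Nat.floor_le_of_le ?_
    rw [lt_div_iff₀ hℓ] at hmv
    nlinarith
  have hκm : ⌊κ * ℓ⌋₊ ≤ m (n + 2) := by
    refine Nat.floor_le_of_le ?_
    rw [lt_div_iff₀ hℓ] at hmv
    nlinarith
  set W := (Fintype.piFinset (fun _ : Fin n => Finset.range (⌊κ * ℓ⌋₊ + 1))).filter fun η =>
    |∑ i, ((η i : ℝ) - ρ) - (r - 2 * ε) * ℓ| ≤ ε * ℓ
  have hWq : ∀ η ∈ W, (m (n + 2) : ℝ) + ∑ i, (η i : ℝ) ≤ N (n + 2) ∧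
      (N (n + 2) : ℝ) - (m (n + 2) + ∑ i, (η i : ℝ)) ≤ 4 * ε * ℓ := by
    intro η hη
    have h := (Finset.mem_filter.1 hη).2
    rw [abs_le, Finset.sum_sub_distrib] at h
    simp only [Finset.sum_const, Finset.card_univ, Fintype.card_fin, nsmul_eq_mul] at h
    rw [← sub_div, ← add_div, lt_div_iff₀ hℓ] at hq1
    rw [← sub_div, ← add_div, div_lt_iff₀ hℓ] at hq2
    push_cast at hq1 hq2
    constructor <;> linarith [h.1, h.2]
  have hmain := mul_sum_le_sum_maxOcc (f := gcMass b γ 1) (fun x => (hν x).le)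
    (gcMass_one_antitone hb hγ0 hγ1) hDm W
    (fun η hη i => (Finset.mem_range_succ_iff.1
      (Fintype.mem_piFinset.1 (Finset.mem_filter.1 hη).1 i)).trans hκm)
    (N := N (n + 2)) (fun η hη => by exact_mod_cast (hWq η hη).1)
    (fun η hη => by
      obtain ⟨h1, h2⟩ := hWq η hη
      have h3 : m (n + 2) + ∑ i, η i ≤ N (n + 2) := by exact_mod_cast h1
      have h4 : N (n + 2) - (m (n + 2) + ∑ i, η i) ≤ ⌊4 * ε * ℓ⌋₊ := by
        refine Nat.le_floor ?_
        rw [Nat.cast_sub h3]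
        push_cast
        exact h2
      omega)
  refine le_trans ?_ hmain
  rw [lt_div_iff₀ hT, Real.lt_log_iff_exp_lt (hν _)] at hlm hlD
  calc _ ≤ Real.exp ((-(c * v ^ (1 - γ)) - e / 3) * T)
          * Real.exp ((-(c * (4 * ε) ^ (1 - γ)) - e / 3) * T)
          * Real.exp (-(T * ((r - 2 * ε) ^ 2 / (2 * σ2) + |r - 2 * ε| * ε / σ2
              + ε ^ 2 / (4 * σ2)))) := by
        rw [← Real.exp_add, ← Real.exp_add, Real.exp_le_exp]
        have := mul_le_mul_of_nonneg_left hεG.le hT.le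
        linarith
    _ ≤ _ := mul_le_mul (mul_le_mul hlm.le hlD.le (Real.exp_pos _).le (hν _).le) hwin
        (Real.exp_pos _).le (mul_pos (hν _) (hν _)).le

end LowerBound

/-! ### Upper bound for the particle number and the maximum -/

section UpperBoundMax

variable {b γ : ℝ}

/-- Union bound over the site where the maximum is attained. -/
lemma sum_maxOcc_le {f : ℕ → ℝ} (hf : ∀ x, 0 ≤ f x) {L : ℕ} (hL : 0 < L) (N m : ℕ) :
    ∑ η ∈ configs L N with maxOcc η = m, ∏ i, f (η i)
      ≤ L * (f m * (∑ x ∈ Finset.range (m + 1), f x) ^ (L - 1)) := by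
  set S : Fin L → Finset (Fin L → ℕ) := fun i =>
    Fintype.piFinset fun j => if j = i then {m} else Finset.range (m + 1)
  have hS_mem : ∀ η : Fin L → ℕ, maxOcc η = m → ∃ i, η ∈ S i := by
    intro η hmax
    have : Nonempty (Fin L) := ⟨⟨0, hL⟩⟩
    obtain ⟨i, -, hi⟩ := Finset.exists_mem_eq_sup Finset.univ Finset.univ_nonempty η
    refine ⟨i, Fintype.mem_piFinset.2 fun j => ?_⟩
    split_ifs with hj
    · subst hj
      rw [Finset.mem_singleton, ← hmax]
      exact hi.symm
    · exact Finset.mem_range_succ_iff.2 (hmax ▸ le_maxOcc η j)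
  have hS : ∀ i, ∑ η ∈ S i, ∏ j, f (η j)
      = f m * (∑ x ∈ Finset.range (m + 1), f x) ^ (L - 1) := by
    intro i
    rw [← Finset.prod_univ_sum, ← Finset.mul_prod_erase _ _ (Finset.mem_univ i), if_pos rfl,
      Finset.sum_singleton]
    congr 1
    rw [Finset.prod_congr rfl (g := fun _ => ∑ x ∈ Finset.range (m + 1), f x)
      (fun j hj => by rw [if_neg (Finset.ne_of_mem_erase hj)]), Finset.prod_const,
      Finset.card_erase_of_mem (Finset.mem_univ i), Finset.card_univ, Fintype.card_fin]
  have hprod : ∀ η : Fin L → ℕ, 0 ≤ ∏ i, f (η i) := fun η => Finset.prod_nonneg fun i _ => hf _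
  set A := (configs L N).filter fun η => maxOcc η = m
  calc _ ≤ ∑ η ∈ A, ∑ i, if η ∈ S i then ∏ j, f (η j) else 0 := by
        refine Finset.sum_le_sum fun η hη => ?_
        obtain ⟨i, hi⟩ := hS_mem η (Finset.mem_filter.1 hη).2
        refine le_trans (le_of_eq (if_pos hi).symm) (Finset.single_le_sum
          (f := fun i => if η ∈ S i then ∏ j, f (η j) else 0) (fun j _ => ?_) (Finset.mem_univ i))
        split_ifs
        exacts [hprod η, le_rfl]
    _ = ∑ i, ∑ η ∈ A with η ∈ S i, ∏ j, f (η j) := by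
        rw [Finset.sum_comm]
        simp_rw [Finset.sum_filter]
    _ ≤ ∑ i, ∑ η ∈ S i, ∏ j, f (η j) :=
        Finset.sum_le_sum fun i _ => Finset.sum_le_sum_of_subset_of_nonneg
          (fun η hη => (Finset.mem_filter.1 hη).2) fun η _ _ => hprod η
    _ = _ := by
        rw [Finset.sum_congr rfl fun i _ => hS i, Finset.sum_const, Finset.card_univ,
          Fintype.card_fin, nsmul_eq_mul]

/-- Upper bound for the joint probability of `N` particles and maximum `m`, by a Chernoff bound
with parameter `r / σ²`. The assumption on `r` and `v` is what makes exponential moments with this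
parameter, truncated at the maximum, behave as in the Gaussian case. -/
lemma eventually_sum_maxOcc_le (hb : 0 < b) (hγ0 : 0 < γ) (hγ1 : γ < 1) {r v : ℝ} (hr : 0 ≤ r)
    (hv : 0 < v) (hrv : r / critVariance b γ * v ^ γ < b / (1 - γ)) {N m : ℕ → ℕ}
    (hN : Tendsto (fun L => ((N L : ℝ) - critDensity b γ * L) / scale γ L) atTop (𝓝 (r + v)))
    (hm : Tendsto (fun L => (m L : ℝ) / scale γ L) atTop (𝓝 v)) {e : ℝ} (he : 0 < e) :
    ∀ᶠ L : ℕ in atTop,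
      ∑ η ∈ configs L (N L) with maxOcc η = m L, ∏ i, gcMass b γ 1 (η i)
        ≤ Real.exp (-(speed γ L
          * (r ^ 2 / (2 * critVariance b γ) + b / (1 - γ) * v ^ (1 - γ) - e))) := by
  set ρ := critDensity b γ with hρ
  set σ2 := critVariance b γ with hσ
  set c := b / (1 - γ) with hc
  have hσ0 : 0 < σ2 := critVariance_pos hb hγ0 hγ1
  have hν := gcMass_one_pos hb hγ0 hγ1
  set t := r / σ2 with ht
  have ht0 : 0 ≤ t := by positivity
  obtain ⟨κ, hκv, hκc⟩ : ∃ κ, v < κ ∧ t * κ ^ γ < c := by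
    have hcont : ContinuousAt (fun κ : ℝ => t * κ ^ γ) v :=
      (ContinuousAt.rpow_const continuousAt_id (Or.inr hγ0.le)).const_mul _
    obtain ⟨κ, h5, h7⟩ := ((hcont.tendsto.eventually_lt_const hrv).filter_mono
      nhdsWithin_le_nhds |>.and (self_mem_nhdsWithin (s := Set.Ioi v))).exists
    exact ⟨κ, h7, h5⟩
  have hκ0 : 0 < κ := hv.trans hκv
  have hscale := tendsto_scale hγ0
  have hn : Tendsto (fun L : ℕ => ((L - 1 : ℕ) : ℝ) / L) atTop (𝓝 1) := by
    have h : Tendsto (fun L : ℕ => 1 - 1 / (L : ℝ)) atTop (𝓝 1) := by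
      simpa using (tendsto_const_nhds.div_atTop
        (tendsto_natCast_atTop_atTop (R := ℝ)) : Tendsto (fun L : ℕ => 1 / (L : ℝ)) _ _).const_sub 1
    refine h.congr' ?_
    filter_upwards [eventually_ge_atTop 1] with L hL
    rw [Nat.cast_sub hL, sub_div, div_self (by positivity)]
    simp
  have hq : Tendsto (fun L : ℕ => t * (((N L : ℝ) - ρ * L) / scale γ L - m L / scale γ L
      + ρ / scale γ L)) atTop (𝓝 (t * r)) := by
    have := ((hN.sub hm).add (tendsto_const_nhds.div_atTop hscale :
      Tendsto (fun L => ρ / scale γ L) _ _)).const_mul t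
    simpa using this
  have he4 : 0 < e / 4 := by positivity
  filter_upwards [isModerateTilt_truncTilt.eventually_pow hb hγ0 hγ1 hκ0
      (le_of_eq (by rw [abs_of_nonneg ht0])) hκc hn he4,
    (tendsto_log_gcMass_scale hb hγ0 hγ1 hv hm).eventually_lt_const (lt_add_of_pos_right _ he4),
    hm.eventually_lt_const hκv, hq.eventually_const_lt (sub_lt_self _ he4),
    eventually_natCast_le_exp_speed hγ0 hγ1 he4, eventually_gt_atTop 0]
    with L hZ hlm hmκ hq1 hLe hL
  have hℓ := scale_pos (γ := γ) hL
  have hT := speed_pos (γ := γ) hL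
  set ℓ := scale γ L
  set T := speed γ L
  set g : ℕ → ℝ := fun x => gcMass b γ 1 x * Real.exp (t * ℓ ^ (-γ) * (x - ρ)) with hg
  have hg0 : ∀ x, 0 ≤ g x := fun x => mul_nonneg (hν x).le (Real.exp_pos _).le
  have hprod : ∀ η ∈ (configs L (N L)).filter (fun η => maxOcc η = m L),
      ∏ i, gcMass b γ 1 (η i)
        = Real.exp (-(T * (t * (((N L : ℝ) - ρ * L) / ℓ)))) * ∏ i, g (η i) := by
    intro η hη
    have hsum : ∑ i, ((η i : ℝ) - ρ) = N L - ρ * L := by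
      rw [← mem_configs.1 (Finset.mem_filter.1 hη).1, Finset.sum_sub_distrib]
      simp [mul_comm]
    rw [hg, Finset.prod_mul_distrib, ← Real.exp_sum, ← Finset.mul_sum, hsum, mul_assoc,
      scale_rpow_neg_mul hL, mul_left_comm, ← Real.exp_add,
      show -(T * (t * (((N L : ℝ) - ρ * L) / ℓ))) + t * (T * (((N L : ℝ) - ρ * L) / ℓ)) = 0 by ring,
      Real.exp_zero, mul_one]
  rw [Finset.sum_congr rfl hprod, ← Finset.mul_sum]
  have hZ' : (∑ x ∈ Finset.range (m L + 1), g x) ^ (L - 1)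
      ≤ Real.exp (T * (t ^ 2 * σ2 / 2 + e / 4)) := by
    refine le_trans ?_ hZ.2
    rw [tsum_truncTilt (by positivity)]
    refine pow_le_pow_left₀ (Finset.sum_nonneg fun x _ => hg0 x) ?_ _
    refine Finset.sum_le_sum_of_subset_of_nonneg ?_ fun x _ _ => hg0 x
    refine Finset.range_subset_range.2 (Nat.succ_le_succ (Nat.le_floor ?_))
    exact ((div_lt_iff₀ hℓ).1 hmκ).le
  have hgm : g (m L) ≤ Real.exp ((-(c * v ^ (1 - γ)) + e / 4) * T)
      * Real.exp (T * (t * ((m L : ℝ) / ℓ - ρ / ℓ))) := by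
    simp only [hg]
    rw [div_lt_iff₀ hT, Real.log_lt_iff_lt_exp (hν _)] at hlm
    refine mul_le_mul hlm.le (le_of_eq ?_) (Real.exp_pos _).le (Real.exp_pos _).le
    rw [mul_assoc, scale_rpow_neg_mul hL]
    congr 1; ring
  calc _ ≤ Real.exp (-(T * (t * (((N L : ℝ) - ρ * L) / ℓ))))
        * (L * (g (m L) * (∑ x ∈ Finset.range (m L + 1), g x) ^ (L - 1))) := by
        gcongr
        exact sum_maxOcc_le hg0 hL _ _
    _ ≤ Real.exp (-(T * (t * (((N L : ℝ) - ρ * L) / ℓ))))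
        * (Real.exp (T * (e / 4)) * ((Real.exp ((-(c * v ^ (1 - γ)) + e / 4) * T)
          * Real.exp (T * (t * ((m L : ℝ) / ℓ - ρ / ℓ))))
          * Real.exp (T * (t ^ 2 * σ2 / 2 + e / 4)))) := by
        have := hg0 (m L)
        have := Finset.sum_nonneg fun x (_ : x ∈ Finset.range (m L + 1)) => hg0 x
        gcongr
    _ ≤ _ := by
        rw [← Real.exp_add, ← Real.exp_add, ← Real.exp_add, ← Real.exp_add, Real.exp_le_exp]
        have h1 := mul_le_mul_of_nonneg_left hq1.le hT.le
        have h2 : t * r = r ^ 2 / σ2 := by rw [ht]; ring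
        have h3 : t ^ 2 * σ2 / 2 = r ^ 2 / σ2 / 2 := by rw [ht]; field_simp
        have h4 : r ^ 2 / (2 * σ2) = r ^ 2 / σ2 / 2 := by field_simp
        rw [h2] at h1
        rw [h3, h4]
        linarith

end UpperBoundMax

/-! ### Upper bound for the particle number -/

section UpperBoundTotal

variable {b γ : ℝ}

lemma sum_configs_le {f : ℕ → ℝ} (hf : ∀ x, 0 ≤ f x) (hs : Summable f) (L N : ℕ) :
    ∑ η ∈ configs L N, ∏ i, f (η i) ≤ (∑' x, f x) ^ L := by
  have hsub : configs L N ⊆ Fintype.piFinset fun _ => Finset.range (N + 1) := by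
    intro η hη
    refine Fintype.mem_piFinset.2 fun i => Finset.mem_range_succ_iff.2 ?_
    rw [← mem_configs.1 hη]
    exact Finset.single_le_sum (fun _ _ => Nat.zero_le _) (Finset.mem_univ i)
  calc _ ≤ ∑ η ∈ Fintype.piFinset fun _ : Fin L => Finset.range (N + 1), ∏ i, f (η i) :=
        Finset.sum_le_sum_of_subset_of_nonneg hsub
          fun η _ _ => Finset.prod_nonneg fun i _ => hf _
    _ = (∑ x ∈ Finset.range (N + 1), f x) ^ L := by
        rw [← Finset.prod_univ_sum, Finset.prod_const, Finset.card_univ, Fintype.card_fin]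
    _ ≤ _ := pow_le_pow_left₀ (Finset.sum_nonneg fun x _ => hf x)
        (hs.sum_le_tsum _ fun x _ => hf x) _

lemma rpow_sum_le_sum_rpow {ι : Type*} (s : Finset ι) {f : ι → ℝ} (hf : ∀ i, 0 ≤ f i) {p : ℝ}
    (hp0 : 0 < p) (hp1 : p ≤ 1) : (∑ i ∈ s, f i) ^ p ≤ ∑ i ∈ s, f i ^ p := by
  induction s using Finset.cons_induction with
  | empty => simp [Real.zero_rpow hp0.ne']
  | cons a s ha ih =>
    rw [Finset.sum_cons, Finset.sum_cons]
    exact (Real.rpow_add_le_add_rpow (hf a) (Finset.sum_nonneg fun i _ => hf i) hp0.le hp1).trans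
      (by gcongr)

/-- If the sites with more than `κ · scale` particles carry `s · scale` particles altogether, the
jump tilt is at least the tilt for a bulk excess reduced by `s` times the stretched exponential for
a single site with `s · scale` particles. The latter is subadditivity of `x ↦ x^(1-γ)`. -/
lemma exp_le_prod_jumpTilt (hb : 0 < b) (hγ0 : 0 < γ) (hγ1 : γ < 1) {t κ c' : ℝ} (ht : 0 ≤ t)
    (hc' : 0 ≤ c') {L N : ℕ} (hL : 0 < L) {η : Fin L → ℕ} (hη : η ∈ configs L N) {s : ℝ}
    (hs : ∑ i with ¬ ((η i : ℝ) ≤ κ * scale γ L), (η i : ℝ) = s * scale γ L) :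
    Real.exp (speed γ L * (t * (((N : ℝ) - critDensity b γ * L) / scale γ L - s)
        + c' * s ^ (1 - γ)))
      ≤ ∏ i, jumpTilt b γ t κ c' (scale γ L) (η i) := by
  have hℓ := scale_pos (γ := γ) hL
  have hT := speed_pos (γ := γ) hL
  set ρ := critDensity b γ with hρ
  have hρ0 : 0 ≤ ρ := critDensity_nonneg hb hγ0 hγ1
  have hs0 : 0 ≤ s := by
    have h : 0 ≤ s * scale γ L := hs ▸ Finset.sum_nonneg fun i _ => Nat.cast_nonneg _
    exact nonneg_of_mul_nonneg_left h hℓ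
  rw [← Finset.prod_filter_mul_prod_filter_not Finset.univ
    (fun i => (η i : ℝ) ≤ κ * scale γ L)]
  have h1 : ∏ i with (η i : ℝ) ≤ κ * scale γ L, jumpTilt b γ t κ c' (scale γ L) (η i)
      = Real.exp (t * scale γ L ^ (-γ)
          * ∑ i with (η i : ℝ) ≤ κ * scale γ L, ((η i : ℝ) - ρ)) := by
    rw [Finset.mul_sum, Real.exp_sum]
    exact Finset.prod_congr rfl fun i hi => by
      rw [jumpTilt, if_pos (Finset.mem_filter.1 hi).2]
  have h2 : ∏ i with ¬ ((η i : ℝ) ≤ κ * scale γ L), jumpTilt b γ t κ c' (scale γ L) (η i)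
      = Real.exp (c' * ∑ i with ¬ ((η i : ℝ) ≤ κ * scale γ L), (η i : ℝ) ^ (1 - γ)) := by
    rw [Finset.mul_sum, Real.exp_sum]
    exact Finset.prod_congr rfl fun i hi => by
      rw [jumpTilt, if_neg (Finset.mem_filter.1 hi).2]
  have h3 : (N : ℝ) - ρ * L - s * scale γ L
      ≤ ∑ i with (η i : ℝ) ≤ κ * scale γ L, ((η i : ℝ) - ρ) := by
    have hsplit := Finset.sum_filter_add_sum_filter_not Finset.univ
      (fun i => (η i : ℝ) ≤ κ * scale γ L) (fun i => (η i : ℝ))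
    have hN : ∑ i, (η i : ℝ) = N := by rw [← mem_configs.1 hη]; push_cast; rfl
    rw [hs, hN] at hsplit
    rw [Finset.sum_sub_distrib, Finset.sum_const, nsmul_eq_mul]
    have hcard : (((Finset.univ.filter fun i => (η i : ℝ) ≤ κ * scale γ L).card : ℕ) : ℝ) ≤ L := by
      have := Finset.card_filter_le (Finset.univ : Finset (Fin L))
        (fun i => (η i : ℝ) ≤ κ * scale γ L)
      rw [Finset.card_univ, Fintype.card_fin] at this
      exact_mod_cast this
    have := mul_le_mul_of_nonneg_right hcard hρ0
    linarith
  have h4 : speed γ L * s ^ (1 - γ)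
      ≤ ∑ i with ¬ ((η i : ℝ) ≤ κ * scale γ L), (η i : ℝ) ^ (1 - γ) := by
    rw [speed, ← Real.mul_rpow hℓ.le hs0, mul_comm, ← hs]
    exact rpow_sum_le_sum_rpow _ (fun i => Nat.cast_nonneg _) (by linarith) (by linarith)
  rw [h1, h2, ← Real.exp_add, Real.exp_le_exp]
  have h5 := mul_le_mul_of_nonneg_left h3
    (mul_nonneg ht (Real.rpow_nonneg hℓ.le (-γ)))
  have h6 := mul_le_mul_of_nonneg_left h4 hc'
  have h7 : t * scale γ L ^ (-γ) * ((N : ℝ) - ρ * L - s * scale γ L)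
      = speed γ L * (t * (((N : ℝ) - ρ * L) / scale γ L - s)) := by
    rw [mul_assoc, scale_rpow_neg_mul hL, sub_div, mul_div_cancel_right₀ _ hℓ.ne']
    ring
  linarith

/-- Upper bound for the probability of `N` particles. For each configuration, with `s · scale`
particles on highly occupied sites, the jump tilt with parameter `(δ - s) / σ²` is at least
`exp (speed · (infimum + tilt cost))`. Finitely many parameters suffice up to a small error, so
that the probability is bounded by a finite sum of total masses of jump tilts. The five errors `e`
come from the lowered rate `c'`, the net, the particle number, the total mass and the cardinality
of the net. -/
lemma eventually_sum_configs_le (hb : 0 < b) (hγ0 : 0 < γ) (hγ1 : γ < 1) {δ : ℝ} (hδ : 0 < δ)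
    {N : ℕ → ℕ}
    (hN : Tendsto (fun L => ((N L : ℝ) - critDensity b γ * L) / scale γ L) atTop (𝓝 δ)) {I : ℝ}
    (hI : ∀ r ∈ Set.Icc 0 δ,
      I ≤ r ^ 2 / (2 * critVariance b γ) + b / (1 - γ) * (δ - r) ^ (1 - γ))
    {e : ℝ} (he : 0 < e) :
    ∀ᶠ L : ℕ in atTop,
      ∑ η ∈ configs L (N L), ∏ i, gcMass b γ 1 (η i)
        ≤ Real.exp (-(speed γ L * (I - 5 * e))) := by
  set ρ := critDensity b γ with hρ
  set σ2 := critVariance b γ with hσ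
  set c := b / (1 - γ) with hc
  have h1γ : 0 < 1 - γ := by linarith
  have hc0 : 0 < c := div_pos hb h1γ
  have hσ0 : 0 < σ2 := critVariance_pos hb hγ0 hγ1
  have hν := gcMass_one_pos hb hγ0 hγ1
  have hδp : 0 < δ ^ (1 - γ) := Real.rpow_pos_of_pos hδ _
  obtain ⟨c', hc'0, hc'c, hc'e⟩ : ∃ c', 0 < c' ∧ c' < c ∧ (c - c') * δ ^ (1 - γ) ≤ e := by
    refine ⟨max (c / 2) (c - e / δ ^ (1 - γ)), lt_max_of_lt_left (by positivity),
      max_lt (by linarith) (by linarith [div_pos he hδp]), ?_⟩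
    rw [← le_div_iff₀ hδp]
    linarith [le_max_right (c / 2) (c - e / δ ^ (1 - γ))]
  obtain ⟨κ, hκ0, hκc⟩ : ∃ κ, 0 < κ ∧ δ / σ2 * κ ^ γ < c' := by
    have hcont : ContinuousAt (fun κ : ℝ => δ / σ2 * κ ^ γ) 0 :=
      (ContinuousAt.rpow_const continuousAt_id (Or.inr hγ0.le)).const_mul _
    have h := hcont.tendsto
    simp only [Real.zero_rpow hγ0.ne', mul_zero] at h
    obtain ⟨κ, h5, h7⟩ := ((h.eventually_lt_const hc'0).filter_mono nhdsWithin_le_nhds |>.and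
      (self_mem_nhdsWithin (s := Set.Ioi (0 : ℝ)))).exists
    exact ⟨κ, h7, h5⟩
  -- a finite net of bulk excesses; the point `0`, that is no tilt, serves configurations whose
  -- highly occupied sites carry more than the whole excess
  obtain ⟨F, hF0, hFI, hF⟩ : ∃ F : Finset ℝ, 0 ∈ F ∧ (∀ x ∈ F, 0 ≤ x ∧ x ≤ δ) ∧
      ∀ r ∈ Set.Icc 0 δ, ∃ x ∈ F, (r - x) ^ 2 / (2 * σ2) ≤ e := by
    obtain ⟨S, hS, hSf, hcov⟩ := (isCompact_Icc (a := (0 : ℝ)) (b := δ)).finite_cover_balls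
      (Real.sqrt_pos.2 (by positivity : 0 < e * (2 * σ2)))
    refine ⟨insert 0 hSf.toFinset, Finset.mem_insert_self _ _, fun x hx => ?_, fun r hr => ?_⟩
    · rcases Finset.mem_insert.1 hx with rfl | hx
      · exact ⟨le_rfl, hδ.le⟩
      · exact hS (hSf.mem_toFinset.1 hx)
    · obtain ⟨x, hx, hxr⟩ := Set.mem_iUnion₂.1 (hcov hr)
      refine ⟨x, Finset.mem_insert_of_mem (hSf.mem_toFinset.2 hx), ?_⟩
      rw [div_le_iff₀ (by positivity), ← sq_abs]
      exact ((Real.lt_sqrt (abs_nonneg _)).1 hxr).le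
  have hn : Tendsto (fun L : ℕ => (L : ℝ) / L) atTop (𝓝 1) := by
    refine tendsto_const_nhds.congr' ?_
    filter_upwards [eventually_gt_atTop 0] with L hL
    exact (div_self (by positivity)).symm
  have htκ : ∀ x ∈ F, |x / σ2| * κ ^ γ ≤ c' := fun x hx => by
    obtain ⟨h1, h2⟩ := hFI x hx
    rw [abs_of_nonneg (by positivity)]
    refine le_trans ?_ hκc.le
    gcongr
  have hpow : ∀ᶠ L : ℕ in atTop, ∀ x ∈ F,
      (∑' y, gcMass b γ 1 y * jumpTilt b γ (x / σ2) κ c' (scale γ L) y) ^ L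
        ≤ Real.exp (speed γ L * ((x / σ2) ^ 2 * σ2 / 2 + e)) := by
    rw [eventually_all_finset]
    intro x hx
    filter_upwards [isModerateTilt_jumpTilt.eventually_pow hb hγ0 hγ1 hκ0 (htκ x hx) hc'c hn he]
      with L hL
    exact hL.2
  have hcard : ∀ᶠ L : ℕ in atTop, (F.card : ℝ) ≤ Real.exp (speed γ L * e) :=
    (Real.tendsto_exp_atTop.comp
      ((tendsto_speed hγ0 hγ1).atTop_mul_const he)).eventually_ge_atTop _
  filter_upwards [hpow, hcard, hN.eventually_const_lt (sub_lt_self δ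
    (by positivity : 0 < e * σ2 / δ)), (tendsto_scale hγ0).eventually_ge_atTop 1,
    eventually_gt_atTop 0] with L hpow hcard hq hℓ1 hL
  have hℓ := scale_pos (γ := γ) hL
  have hT := speed_pos (γ := γ) hL
  set ℓ := scale γ L
  set T := speed γ L
  have hJ0 : ∀ x y, 0 ≤ jumpTilt b γ (x / σ2) κ c' ℓ y := fun x y =>
    (isModerateTilt_jumpTilt (κ := κ)).nonneg ℓ y
  -- the exponent attained by the best parameter in the net
  have hopt : ∀ s, 0 ≤ s → ∃ x ∈ F, I - 3 * e + (x / σ2) ^ 2 * σ2 / 2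
      ≤ x / σ2 * (((N L : ℝ) - ρ * L) / ℓ - s) + c' * s ^ (1 - γ) := by
    intro s hs
    rcases le_or_gt s δ with hsδ | hsδ
    · obtain ⟨x, hx, hxe⟩ := hF (δ - s) ⟨by linarith, by linarith⟩
      refine ⟨x, hx, ?_⟩
      obtain ⟨hx0, hxδ⟩ := hFI x hx
      have h1 := hI (δ - s) ⟨by linarith, by linarith⟩
      rw [sub_sub_cancel] at h1
      have h2 : (c - c') * s ^ (1 - γ) ≤ e := le_trans (by gcongr) hc'e
      have h3 : x / σ2 * (δ - e * σ2 / δ - s)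
          ≤ x / σ2 * (((N L : ℝ) - ρ * L) / ℓ - s) := by gcongr
      have h4 : x / σ2 * (e * σ2 / δ) ≤ e := by
        rw [show x / σ2 * (e * σ2 / δ) = x / δ * e by field_simp]
        exact mul_le_of_le_one_left he.le ((div_le_one hδ).2 hxδ)
      have h5 : x / σ2 * (δ - s)
          = (δ - s) ^ 2 / (2 * σ2) - (δ - s - x) ^ 2 / (2 * σ2) + (x / σ2) ^ 2 * σ2 / 2 := by
        field_simp; ring
      linarith
    · refine ⟨0, hF0, ?_⟩
      have h1 := hI 0 ⟨le_rfl, hδ.le⟩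
      have h2 : c' * δ ^ (1 - γ) ≤ c' * s ^ (1 - γ) := by gcongr
      simp only [sub_zero] at h1
      norm_num at h1 ⊢
      linarith
  have hpt : ∀ η ∈ configs L (N L), ∏ i, gcMass b γ 1 (η i)
      ≤ ∑ x ∈ F, Real.exp (-(T * (I - 3 * e + (x / σ2) ^ 2 * σ2 / 2)))
          * ∏ i, gcMass b γ 1 (η i) * jumpTilt b γ (x / σ2) κ c' ℓ (η i) := by
    intro η hη
    set s := (∑ i with ¬ ((η i : ℝ) ≤ κ * ℓ), (η i : ℝ)) / ℓ with hs
    have hs0 : 0 ≤ s := div_nonneg (Finset.sum_nonneg fun i _ => Nat.cast_nonneg _) hℓ.le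
    obtain ⟨x, hx, hxs⟩ := hopt s hs0
    have h1 := exp_le_prod_jumpTilt hb hγ0 hγ1 (t := x / σ2) (κ := κ)
      (div_nonneg (hFI x hx).1 hσ0.le) hc'0.le hL hη (s := s) (div_mul_cancel₀ _ hℓ.ne').symm
    have hprod : 0 ≤ ∏ i, gcMass b γ 1 (η i) := Finset.prod_nonneg fun i _ => (hν _).le
    refine le_trans ?_ (Finset.single_le_sum (f := fun x =>
      Real.exp (-(T * (I - 3 * e + (x / σ2) ^ 2 * σ2 / 2)))
        * ∏ i, gcMass b γ 1 (η i) * jumpTilt b γ (x / σ2) κ c' ℓ (η i)) (fun y _ =>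
      mul_nonneg (Real.exp_pos _).le (Finset.prod_nonneg fun i _ =>
        mul_nonneg (hν _).le (hJ0 y _))) hx)
    rw [Finset.prod_mul_distrib, mul_left_comm]
    refine le_mul_of_one_le_right hprod ?_
    calc (1 : ℝ) = Real.exp (-(T * (I - 3 * e + (x / σ2) ^ 2 * σ2 / 2)))
          * Real.exp (T * (I - 3 * e + (x / σ2) ^ 2 * σ2 / 2)) := by
          rw [← Real.exp_add, neg_add_cancel, Real.exp_zero]
      _ ≤ _ := by
          gcongr
          exact le_trans (Real.exp_le_exp.2 (by gcongr)) h1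
  calc _ ≤ ∑ η ∈ configs L (N L), ∑ x ∈ F,
        Real.exp (-(T * (I - 3 * e + (x / σ2) ^ 2 * σ2 / 2)))
          * ∏ i, gcMass b γ 1 (η i) * jumpTilt b γ (x / σ2) κ c' ℓ (η i) :=
        Finset.sum_le_sum hpt
    _ = ∑ x ∈ F, Real.exp (-(T * (I - 3 * e + (x / σ2) ^ 2 * σ2 / 2)))
          * ∑ η ∈ configs L (N L),
            ∏ i, gcMass b γ 1 (η i) * jumpTilt b γ (x / σ2) κ c' ℓ (η i) := by
        rw [Finset.sum_comm]
        simp_rw [Finset.mul_sum]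
    _ ≤ ∑ x ∈ F, Real.exp (-(T * (I - 4 * e))) := by
        refine Finset.sum_le_sum fun x hx => ?_
        have h1 := sum_configs_le (f := fun y =>
          gcMass b γ 1 y * jumpTilt b γ (x / σ2) κ c' ℓ y)
          (fun y => mul_nonneg (hν y).le (hJ0 x y))
          ((isModerateTilt_jumpTilt.summable_and_tendsto hb hγ0 hγ1 hκ0 (htκ x hx) hc'c).1 ℓ hℓ1)
          L (N L)
        calc _ ≤ Real.exp (-(T * (I - 3 * e + (x / σ2) ^ 2 * σ2 / 2)))
              * Real.exp (T * ((x / σ2) ^ 2 * σ2 / 2 + e)) := by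
              gcongr
              exact h1.trans (hpow x hx)
          _ = _ := by rw [← Real.exp_add]; congr 1; ring
    _ = F.card * Real.exp (-(T * (I - 4 * e))) := by rw [Finset.sum_const, nsmul_eq_mul]
    _ ≤ Real.exp (T * e) * Real.exp (-(T * (I - 4 * e))) := by gcongr
    _ = _ := by rw [← Real.exp_add]; congr 1; ring

end UpperBoundTotal

/-! ### The canonical measure and logarithmic limits -/

section Canonical

variable {b γ : ℝ}

/-- The normalisation of the single site measure cancels in the canonical measure. -/
lemma canonicalProb_maxOcc (hb : 0 < b) (hγ0 : 0 < γ) (hγ1 : γ < 1) (L N m : ℕ) :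
    canonicalProb b γ L N {η | maxOcc η = m}
      = (∑ η ∈ configs L N with maxOcc η = m, ∏ i, gcMass b γ 1 (η i))
        / ∑ η ∈ configs L N, ∏ i, gcMass b γ 1 (η i) := by
  have hz := (siteZ_one_pos hb hγ0 hγ1).ne'
  have hprod : ∀ η : Fin L → ℕ, ∏ i, gcMass b γ 1 (η i)
      = (∏ i, weight b γ (η i)) / siteZ b γ 1 ^ L := fun η => by
    simp_rw [gcMass_one]
    rw [Finset.prod_div_distrib, Finset.prod_const, Finset.card_univ, Fintype.card_fin]
  simp_rw [hprod]
  rw [← Finset.sum_div, ← Finset.sum_div, div_div_div_cancel_right₀ (pow_ne_zero _ hz),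
    canonicalProb, Finset.sum_div, Finset.sum_filter]
  refine Finset.sum_congr rfl fun η _ => ?_
  rw [Set.indicator_apply]
  rfl

lemma tendsto_log_div_of_exp_bounds {T P : ℕ → ℝ} {x : ℝ} (hT : ∀ᶠ L in atTop, 0 < T L)
    (hlow : ∀ e, 0 < e → ∀ᶠ L in atTop, Real.exp (-(T L * (x + e))) ≤ P L)
    (hup : ∀ e, 0 < e → ∀ᶠ L in atTop, P L ≤ Real.exp (-(T L * (x - e)))) :
    Tendsto (fun L => Real.log (P L) / T L) atTop (𝓝 (-x)) := by
  rw [Metric.tendsto_nhds]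
  intro e he
  filter_upwards [hT, hlow (e / 2) (by positivity), hup (e / 2) (by positivity)] with L h0 h1 h2
  have hP : 0 < P L := (Real.exp_pos _).trans_le h1
  rw [← Real.le_log_iff_exp_le hP] at h1
  rw [← Real.log_le_iff_le_exp hP] at h2
  rw [Real.dist_eq, abs_lt, lt_sub_iff_add_lt, sub_lt_iff_lt_add, lt_div_iff₀ h0, div_lt_iff₀ h0]
  constructor <;> nlinarith [mul_pos h0 he]

end Canonical

end ZeroRange

theorem theorem3 (b γ : ℝ) (hb : 0 < b) (hγ0 : 0 < γ) (hγ1 : γ < 1)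
    (α β : ℝ) (hα : α = γ / (1 + γ)) (hβ : β = (1 - γ) / (1 + γ))
    (δρ δρbg : ℝ) (hbg0 : 0 ≤ δρbg) (hbg1 : δρbg < δρ)
    (hcond : δρbg / ZeroRange.critVariance b γ < b / ((1 - γ) * (δρ - δρbg) ^ γ))
    (N m : ℕ → ℕ)
    (hN : (fun L : ℕ => (N L : ℝ) - (ZeroRange.critDensity b γ * (L : ℝ) + δρ * (L : ℝ) ^ (1 - α)))
      =o[atTop] fun L : ℕ => (L : ℝ) ^ (1 - α))
    (hm : (fun L : ℕ => (m L : ℝ) - (δρ - δρbg) * (L : ℝ) ^ (1 - α))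
      =o[atTop] fun L : ℕ => (L : ℝ) ^ (1 - α)) :
    (∀ᶠ L : ℕ in atTop,
      0 < ZeroRange.canonicalProb b γ L (N L) {η | ZeroRange.maxOcc η = m L}) ∧
    Tendsto (fun L : ℕ => (L : ℝ) ^ (1 - β) * ZeroRange.rateFun b γ L (N L) (m L)) atTop
      (𝓝 (δρbg ^ 2 / (2 * ZeroRange.critVariance b γ) + b / (1 - γ) * (δρ - δρbg) ^ (1 - γ)
        - sInf ((fun r : ℝ => r ^ 2 / (2 * ZeroRange.critVariance b γ)
            + b / (1 - γ) * (δρ - r) ^ (1 - γ)) '' Set.Ioo 0 δρ))) := by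
  open ZeroRange in
  have h1γ : 0 < 1 - γ := by linarith
  have hγ' : (1 + γ) ≠ 0 := by linarith
  have hδ : 0 < δρ := by linarith
  have hv : 0 < δρ - δρbg := by linarith
  have hσ0 := critVariance_pos hb hγ0 hγ1
  set σ2 := critVariance b γ with hσ
  set ρ := critDensity b γ with hρ
  set c := b / (1 - γ) with hc
  have hc0 : 0 < c := div_pos hb h1γ
  have hscale : ∀ L : ℕ, (L : ℝ) ^ (1 - α) = scale γ L := fun L => by
    rw [scale, hα]; congr 1; field_simp; ring
  simp_rw [hscale] at hN hm
  have hNt : Tendsto (fun L => ((N L : ℝ) - ρ * L) / scale γ L) atTop (𝓝 δρ) := by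
    have h := hN.tendsto_div_nhds_zero.add_const δρ
    rw [zero_add] at h
    refine h.congr' ?_
    filter_upwards [eventually_gt_atTop 0] with L hL
    have := (scale_pos (γ := γ) hL).ne'
    field_simp
    ring
  have hmt : Tendsto (fun L => (m L : ℝ) / scale γ L) atTop (𝓝 (δρ - δρbg)) := by
    have h := hm.tendsto_div_nhds_zero.add_const (δρ - δρbg)
    rw [zero_add] at h
    refine h.congr' ?_
    filter_upwards [eventually_gt_atTop 0] with L hL
    have := (scale_pos (γ := γ) hL).ne'
    field_simp
    ring
  have hTpos : ∀ᶠ L in atTop, 0 < speed γ L :=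
    (eventually_gt_atTop 0).mono fun L hL => speed_pos hL
  set J : ℝ → ℝ := fun r => r ^ 2 / (2 * σ2) + c * (δρ - r) ^ (1 - γ) with hJ
  set I := sInf (J '' Set.Ioo 0 δρ) with hI
  -- the joint probability of particle number and maximum
  set P : ℕ → ℝ := fun L =>
    ∑ η ∈ configs L (N L) with maxOcc η = m L, ∏ i, gcMass b γ 1 (η i) with hP
  set Q : ℕ → ℝ := fun L => ∑ η ∈ configs L (N L), ∏ i, gcMass b γ 1 (η i) with hQ
  have hprod : ∀ {L : ℕ} (η : Fin L → ℕ), 0 ≤ ∏ i, gcMass b γ 1 (η i) := fun η =>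
    Finset.prod_nonneg fun i _ => (gcMass_one_pos hb hγ0 hγ1 _).le
  have hPlow : ∀ e, 0 < e → ∀ᶠ L in atTop, Real.exp (-(speed γ L * (J δρbg + e))) ≤ P L :=
    fun e he => eventually_le_sum_maxOcc hb hγ0 hγ1 hv (by simpa using hNt) hmt he
  have hPlim : Tendsto (fun L => Real.log (P L) / speed γ L) atTop (𝓝 (-J δρbg)) := by
    refine tendsto_log_div_of_exp_bounds hTpos hPlow fun e he => ?_
    refine eventually_sum_maxOcc_le hb hγ0 hγ1 hbg0 hv ?_ (by simpa using hNt) hmt he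
    rw [← div_div, lt_div_iff₀ (by positivity)] at hcond
    exact hcond
  -- the probability of the particle number
  have hJcont : Continuous J := by
    have : Continuous fun r : ℝ => (δρ - r) ^ (1 - γ) :=
      Continuous.rpow_const (by fun_prop) fun _ => Or.inr h1γ.le
    fun_prop
  have hJbdd : BddBelow (J '' Set.Ioo 0 δρ) := by
    refine ⟨0, ?_⟩
    rintro _ ⟨r, hr, rfl⟩
    have : 0 ≤ δρ - r := by linarith [hr.2]
    positivity
  have hIle : ∀ r ∈ Set.Icc 0 δρ, I ≤ J r := by
    intro r hr
    rw [← closure_Ioo hδ.ne] at hr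
    refine closure_minimal (fun r hr => ?_) (isClosed_le continuous_const hJcont) hr
    exact csInf_le hJbdd (Set.mem_image_of_mem J hr)
  have hPQ : ∀ (k : ℕ → ℕ) L, ∑ η ∈ configs L (N L) with maxOcc η = k L,
      ∏ i, gcMass b γ 1 (η i) ≤ Q L := fun k L =>
    Finset.sum_le_sum_of_subset_of_nonneg (Finset.filter_subset _ _) fun η _ _ => hprod η
  have hQlim : Tendsto (fun L => Real.log (Q L) / speed γ L) atTop (𝓝 (-I)) := by
    refine tendsto_log_div_of_exp_bounds hTpos (fun e he => ?_) fun e he => ?_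
    · -- a nearly optimal bulk excess `r`, with the rest on one site
      obtain ⟨_, ⟨r, hr, rfl⟩, hrI⟩ := exists_lt_of_csInf_lt
        ((Set.nonempty_Ioo.2 hδ).image J) (lt_add_of_pos_right I (half_pos he))
      have hk : Tendsto (fun L => (⌊(δρ - r) * scale γ L⌋₊ : ℝ) / scale γ L) atTop
          (𝓝 (δρ - r)) :=
        (tendsto_nat_floor_mul_div_atTop (by linarith [hr.2])).comp (tendsto_scale hγ0)
      filter_upwards [eventually_le_sum_maxOcc hb hγ0 hγ1 (r := r) (sub_pos.2 hr.2)
        (by simpa using hNt) hk (half_pos he), hTpos] with L hL hT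
      refine le_trans ?_ (hL.trans (hPQ (fun L => ⌊(δρ - r) * scale γ L⌋₊) L))
      have hle : J r + e / 2 ≤ I + e := by linarith
      exact Real.exp_le_exp.2 (neg_le_neg (mul_le_mul_of_nonneg_left hle hT.le))
    · filter_upwards [eventually_sum_configs_le hb hγ0 hγ1 hδ hNt hIle
        (by positivity : 0 < e / 5)] with L hL
      rwa [mul_div_cancel₀ _ (by norm_num : (5 : ℝ) ≠ 0)] at hL
  have hPpos : ∀ᶠ L in atTop, 0 < P L :=
    (hPlow 1 one_pos).mono fun L hL => (Real.exp_pos _).trans_le hL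
  refine ⟨?_, ?_⟩
  · filter_upwards [hPpos] with L hL
    rw [canonicalProb_maxOcc hb hγ0 hγ1]
    exact div_pos hL (hL.trans_le (hPQ m L))
  · have hlim := hQlim.sub hPlim
    rw [show -I - -J δρbg = J δρbg - I by ring] at hlim
    refine hlim.congr' ?_
    filter_upwards [hPpos, eventually_gt_atTop 0] with L hL hL0
    have hQL : 0 < Q L := hL.trans_le (hPQ m L)
    rw [rateFun, canonicalProb_maxOcc hb hγ0 hγ1]
    change _ = _ * (_ * Real.log (P L / Q L))
    have hL' : (0 : ℝ) < L := by exact_mod_cast hL0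
    have hspeed : speed γ L = (L : ℝ) ^ β := by
      rw [speed, scale, ← Real.rpow_mul hL'.le, hβ]; congr 1; ring
    rw [Real.log_div hL.ne' hQL.ne', hspeed, Real.rpow_sub hL', Real.rpow_one]
    field_simp
    ring
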